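/- All graphs are simple and undirected, with vertex set $\{0,\dots,n-1\}$, $n\ge 1$. Fix a constant $a>0$. In the general sparse model, an algorithm is given $n$ and a bound $m\ge a n$ on the number of edges (so $m=\Omega(n)$) of an unknown input graph $G$ on $n$ vertices. It accesses $G$ through a neighbor oracle: a query is either a vertex $v$, answered by $\deg(v)$, or a pair $(v,i)$, answered by the $i$-th neighbor of $v$ in an arbitrary fixed ordering of the neighbors of $v$ (or by a special symbol if there is none). The distance of two graphs on the same vertex set is the number of unordered pairs that are an edge in exactly one of them, divided by $m$. The distance of $G$ from a property $\mathcal P$ is the minimum of its distances to graphs in $\mathcal P$ on the same vertex set ($\infty$ if there are none). $G$ is $\epsilon$-close to $\mathcal P$ if this distance is at most $\epsilon$, and $\epsilon$-far otherwise. An $(\epsilon_1,\epsilon_2)$-tolerant tester for $\mathcal P$ is a randomized (computable, uniform in $n$ and $m$) algorithm which, for all such $n$, $m$, all $G$ with $n$ vertices and at most $m$ edges, and all orderings of the neighbors, always halts after at most $q(m)$ oracle queries, where $q(m)=o(m)$ as $m\to\infty$ and $q$ does not depend on $n$ or $G$; accepts with probability at least $2/3$ if $G$ is $\epsilon_1$-close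 to $\mathcal P$; and accepts with probability at most $1/3$ if $G$ is $\epsilon_2$-far from $\mathcal P$. A graph $(V,E)$ is $k$-edge-connected if for every nonempty $U\subsetneq V$ at least $k$ edges join $U$ to $V\setminus U$. Corollary. For every integer $k\ge 1$ and all real $\alpha,\beta,c,\epsilon>0$ (and every $a>0$ as above) there is an $(\epsilon,\,(2k+\alpha)\epsilon+ck/2+\beta)$-tolerant tester for $k$-edge-connectivity. -/

import Mathlib

namespace GraphTesting

open scoped ENNReal

/-! ### Graphs, distance, properties

Graphs are simple undirected graphs on the vertex set `Fin n = {0, …, n - 1}`; `m` is the a priori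
upper bound on the number of edges, by which distances are normalized. -/

/-- A graph property: for every `n`, a set of graphs on `n` vertices. -/
abbrev GraphProperty : Type := (n : ℕ) → Set (SimpleGraph (Fin n))

/-- The number of unordered pairs which are an edge in exactly one of the two graphs,
divided by `m`. -/
noncomputable def graphDist {n : ℕ} (m : ℕ) (G₁ G₂ : SimpleGraph (Fin n)) : ℝ≥0∞ :=
  ((symmDiff G₁.edgeSet G₂.edgeSet).ncard : ℝ≥0∞) / (m : ℝ≥0∞)

/-- The distance of a graph from a property: the minimum of the distances to the graphs (on the
same vertex set) that have the property. It is `⊤` if there is no such graph. -/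
noncomputable def distToProperty {n : ℕ} (m : ℕ) (G : SimpleGraph (Fin n))
    (P : GraphProperty) : ℝ≥0∞ :=
  ⨅ G' ∈ P n, graphDist m G G'

/-- `G` is `ε`-close to `P`. -/
def IsClose {n : ℕ} (m : ℕ) (ε : ℝ) (G : SimpleGraph (Fin n)) (P : GraphProperty) : Prop :=
  distToProperty m G P ≤ ENNReal.ofReal ε

/-- `G` is `ε`-far from `P`. -/
def IsFar {n : ℕ} (m : ℕ) (ε : ℝ) (G : SimpleGraph (Fin n)) (P : GraphProperty) : Prop :=
  ¬ IsClose m ε G P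

/-- The degree of a vertex set `U`: the number of edges between `U` and its complement. -/
noncomputable def cutDegree {n : ℕ} (G : SimpleGraph (Fin n)) (U : Set (Fin n)) : ℕ :=
  {p : Fin n × Fin n | p.1 ∈ U ∧ p.2 ∉ U ∧ G.Adj p.1 p.2}.ncard

/-- `k`-edge-connectivity: every nonempty proper subset of the vertices has degree at least `k`. -/
def kEdgeConnectivity (k : ℕ) : GraphProperty := fun n =>
  {G | ∀ U : Set (Fin n), U.Nonempty → U ≠ Set.univ → k ≤ cutDegree G U}

/-! ### Neighbor oracles -/

/-- An adjacency list representation of `G`: every vertex comes with its neighbors, listed without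
repetition in some fixed (arbitrary) order. -/
structure NeighborOracle {n : ℕ} (G : SimpleGraph (Fin n)) where
  nbrs : Fin n → List (Fin n)
  nodup : ∀ v, (nbrs v).Nodup
  mem_nbrs : ∀ v u, u ∈ nbrs v ↔ G.Adj v u

/-- The answer to a degree query at `v`. The answer `n`, which is never a degree, signals that `v`
is not a vertex. -/
def NeighborOracle.degreeAnswer {n : ℕ} {G : SimpleGraph (Fin n)} (O : NeighborOracle G)
    (v : ℕ) : ℕ :=
  if h : v < n then (O.nbrs ⟨v, h⟩).length else n

/-- The answer to the query for the `i`-th neighbor of `v` (counted from `0`). The answer `n`,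
which is never a vertex, signals that there is no such vertex or no such neighbor. -/
def NeighborOracle.neighborAnswer {n : ℕ} {G : SimpleGraph (Fin n)} (O : NeighborOracle G)
    (v i : ℕ) : ℕ :=
  if h : v < n then ((O.nbrs ⟨v, h⟩).map Fin.val).getD i n else n

/-! ### Randomized algorithms with access to a neighbor oracle -/

/-- The actions of an algorithm: halt with an output (`true` means accept), draw a uniformly random
number from `{0, …, N}`, query the degree of `v`, or query the `i`-th neighbor of `v`. -/
inductive Action : Type
  | halt (b : Bool)
  | draw (N : ℕ)
  | degree (v : ℕ)
  | neighbor (v i : ℕ)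

/-- Actions as a sum type, used to encode actions by natural numbers. -/
def Action.equivSum : Action ≃ (Bool ⊕ ℕ) ⊕ (ℕ ⊕ (ℕ × ℕ)) where
  toFun
    | .halt b => .inl (.inl b)
    | .draw N => .inl (.inr N)
    | .degree v => .inr (.inl v)
    | .neighbor v i => .inr (.inr (v, i))
  invFun
    | .inl (.inl b) => .halt b
    | .inl (.inr N) => .draw N
    | .inr (.inl v) => .degree v
    | .inr (.inr (v, i)) => .neighbor v i
  left_inv x := by cases x <;> rfl
  right_inv x := by rcases x with (b | N) | (v | ⟨v, i⟩) <;> rfl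

instance : Primcodable Action := Primcodable.ofEquiv _ Action.equivSum

/-- A (uniform) randomized algorithm with query access to a neighbor oracle. Its inputs are the
number `n` of vertices and the bound `m`. The next action is a computable function of the inputs
and of the list, in chronological order, of all numbers received so far (random draws and answers
of the oracle). -/
structure Algorithm where
  next : ℕ → ℕ → List ℕ → Action
  computable : Computable fun x : ℕ × ℕ × List ℕ => next x.1 x.2.1 x.2.2

/-- Count one more query. -/
def countQuery : Option (Bool × ℕ) → Option (Bool × ℕ) :=
  Option.map fun r => (r.1, r.2 + 1)

/-- Run a strategy for at most `T` steps, after the numbers in `h` have been received. The outcome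
is `none` if it has not halted by then, and otherwise its output together with the number of
queries that it has made to the oracle in these steps. -/
noncomputable def run {n : ℕ} {G : SimpleGraph (Fin n)} (O : NeighborOracle G)
    (next : List ℕ → Action) : ℕ → List ℕ → PMF (Option (Bool × ℕ))
  | 0, _ => PMF.pure none
  | T + 1, h =>
    match next h with
    | .halt b => PMF.pure (some (b, 0))
    | .draw N => (PMF.uniformOfFintype (Fin (N + 1))).bind fun r => run O next T (h ++ [r.val])
    | .degree v => (run O next T (h ++ [O.degreeAnswer v])).map countQuery
    | .neighbor v i => (run O next T (h ++ [O.neighborAnswer v i])).map countQuery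

/-- The probability that the output is `true`, for a given distribution of outcomes. -/
noncomputable def acceptProb (μ : PMF (Option (Bool × ℕ))) : ℝ≥0∞ :=
  μ.map (Option.map Prod.fst) (some true)

/-- `A` is an `(ε₁, ε₂)`-tolerant tester for the property `P` in the general sparse model, where
inputs are graphs with `n` vertices and at most `m` edges, and `m ≥ a * n` for a fixed `a > 0`
(so `m = Ω(n)`). The query bound `q` is `o(m)`, uniformly in `n`, and holds for all coin tosses,
all input graphs and all orderings of the adjacency lists. -/
def IsTolerantTester (a ε₁ ε₂ : ℝ) (P : GraphProperty) (A : Algorithm) : Prop :=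
  ∃ q : ℕ → ℕ,
    (fun m => (q m : ℝ)) =o[Filter.atTop] (fun m : ℕ => (m : ℝ)) ∧
    ∀ n m : ℕ, 0 < n → a * (n : ℝ) ≤ (m : ℝ) →
      ∃ T : ℕ, ∀ G : SimpleGraph (Fin n), G.edgeSet.ncard ≤ m → ∀ O : NeighborOracle G,
        (∀ o ∈ (run O (A.next n m) T []).support,
          ∃ (b : Bool) (c : ℕ), o = some (b, c) ∧ c ≤ q m) ∧
        (IsClose m ε₁ G P → 2 / 3 ≤ acceptProb (run O (A.next n m) T [])) ∧
        (IsFar m ε₂ G P → acceptProb (run O (A.next n m) T []) ≤ 1 / 3)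

end GraphTesting

namespace GraphTesting

open scoped ENNReal

/-! ### Deficient sets -/

section Deficient

variable {n : ℕ} {G G' : SimpleGraph (Fin n)} {k : ℕ}

/-! Call a nonempty proper vertex set deficient if fewer than `k` edges leave it. Cut degrees are
posimodular, so the inclusion-minimal deficient sets are pairwise disjoint. Let ℓ be their number;
each is represented by its least element, its leader. Up to an additive constant, ℓ determines the
edit distance d to `k`-edge-connectivity within a factor 2k. On the one hand ℓ / 2 ≤ d, because
every minimal deficient set needs a new edge leaving it, and one edge serves at most two disjoint
sets (`ncard_leaders_le`). On the other hand d ≤ kℓ + k(k + 1) for n > k, because every deficient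
set and its complement both contain leaders, so that joining all leaders to `k` hubs repairs every
cut (`exists_kEdgeConnected_of_lt`). Since n = O(m), it suffices to estimate ℓ up to a small
multiple of n.

This estimate is local. Fewer than n / s of the minimal deficient sets have more than s elements. A
smaller one induces a connected graph and its vertices have degree less than s + k, so exploring a
bounded part of the graph around a root decides whether the root is its leader
(`displaysLeader_iff`). By Chebyshev's inequality a constant number of random roots suffices
(`outputProb_explorerNext_le`), so the number of queries is constant. The finitely many n for which
the additive terms matter are handled by reading the whole graph.

Computability comes from finiteness: for small n there are finitely many adjacency lists, and for
large n the decision depends only on the order pattern of a bounded number of entries. Both are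
hard-coded in finite tables. -/

open Classical in
theorem cutDegree_eq_sum (G : SimpleGraph (Fin n)) (U : Set (Fin n)) :
    cutDegree G U = ∑ x, ∑ y, if x ∈ U ∧ y ∉ U ∧ G.Adj x y then 1 else 0 := by
  rw [← Fintype.sum_prod_type' (fun x y => if x ∈ U ∧ y ∉ U ∧ G.Adj x y then 1 else 0),
    Finset.sum_boole, cutDegree, Set.ncard_eq_toFinset_card']
  simp

-- Counting separated pairs in both orders gives an expression symmetric in `U` and its complement,
-- so that cut inequalities can be checked on one pair of vertices at a time.
open Classical in
theorem two_mul_cutDegree (G : SimpleGraph (Fin n)) (U : Set (Fin n)) :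
    2 * cutDegree G U =
      ∑ x, ∑ y, if ¬ (x ∈ U ↔ y ∈ U) ∧ G.Adj x y then 1 else 0 := by
  have h : cutDegree G U = ∑ x, ∑ y, if y ∈ U ∧ x ∉ U ∧ G.Adj x y then 1 else 0 := by
    rw [cutDegree_eq_sum, Finset.sum_comm]
    simp only [G.adj_comm]
  rw [two_mul]
  nth_rw 1 [cutDegree_eq_sum]
  rw [h, ← Finset.sum_add_distrib]
  refine Finset.sum_congr rfl fun x _ => ?_
  rw [← Finset.sum_add_distrib]
  refine Finset.sum_congr rfl fun y _ => ?_
  by_cases hx : x ∈ U <;> by_cases hy : y ∈ U <;> simp [hx, hy]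

/-- Posimodularity of cuts; the inequality already holds for the contribution of each ordered pair
of vertices. -/
theorem cutDegree_sdiff_add_cutDegree_sdiff_le (G : SimpleGraph (Fin n)) (U W : Set (Fin n)) :
    cutDegree G (U \ W) + cutDegree G (W \ U) ≤ cutDegree G U + cutDegree G W := by
  classical
  have h : 2 * cutDegree G (U \ W) + 2 * cutDegree G (W \ U) ≤
      2 * cutDegree G U + 2 * cutDegree G W := by
    simp only [two_mul_cutDegree, ← Finset.sum_add_distrib]
    refine Finset.sum_le_sum fun x _ => Finset.sum_le_sum fun y _ => ?_
    by_cases hA : G.Adj x y <;> by_cases h₁ : x ∈ U <;> by_cases h₂ : y ∈ U <;>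
      by_cases h₃ : x ∈ W <;> by_cases h₄ : y ∈ W <;> simp [hA, h₁, h₂, h₃, h₄]
  omega

theorem cutDegree_compl (G : SimpleGraph (Fin n)) (U : Set (Fin n)) :
    cutDegree G Uᶜ = cutDegree G U := by
  classical
  have h : 2 * cutDegree G Uᶜ = 2 * cutDegree G U := by
    simp only [two_mul_cutDegree, Set.mem_compl_iff, not_iff_not]
  omega

theorem cutDegree_mono (h : G ≤ G') (U : Set (Fin n)) : cutDegree G U ≤ cutDegree G' U :=
  Set.ncard_le_ncard (fun _ hp => ⟨hp.1, hp.2.1, h hp.2.2⟩) (Set.toFinite _)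

/-- The sets violating `k`-edge-connectivity. -/
def IsDeficient (k : ℕ) (G : SimpleGraph (Fin n)) (U : Set (Fin n)) : Prop :=
  U.Nonempty ∧ U ≠ Set.univ ∧ cutDegree G U < k

theorem mem_kEdgeConnectivity_iff :
    G ∈ kEdgeConnectivity k n ↔ ∀ U, ¬ IsDeficient k G U := by
  refine forall_congr' fun U => ?_
  simp only [IsDeficient, not_and, not_lt]

theorem IsDeficient.compl {U : Set (Fin n)} (h : IsDeficient k G U) : IsDeficient k G Uᶜ :=
  ⟨Set.nonempty_compl.2 h.2.1, by simpa [Set.compl_univ_iff] using h.1.ne_empty,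
    by rw [cutDegree_compl]; exact h.2.2⟩

theorem IsDeficient.exists_minimal {U : Set (Fin n)} (h : IsDeficient k G U) :
    ∃ W ⊆ U, Minimal (IsDeficient k G) W := by
  obtain ⟨W, hWU, hW⟩ := exists_minimal_le_of_wellFoundedLT (IsDeficient k G) U h
  exact ⟨W, hWU, hW⟩

theorem le_cutDegree_of_ssubset {U W : Set (Fin n)} (hU : Minimal (IsDeficient k G) U)
    (hW : W.Nonempty) (hWU : W ⊂ U) : k ≤ cutDegree G W := by
  by_contra! h
  exact hWU.not_subset <| hU.2 ⟨hW, fun e => hWU.not_subset (e ▸ Set.subset_univ U), h⟩ hWU.subset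

/-- Minimal deficient sets are pairwise disjoint. -/
theorem minimal_isDeficient_unique {U W : Set (Fin n)} (hU : Minimal (IsDeficient k G) U)
    (hW : Minimal (IsDeficient k G) W) {x : Fin n} (hxU : x ∈ U) (hxW : x ∈ W) : U = W := by
  by_contra hne
  have h₁ : (U \ W).Nonempty := Set.sdiff_nonempty.2 fun h => hne (h.antisymm (hW.2 hU.1 h))
  have h₂ : (W \ U).Nonempty := Set.sdiff_nonempty.2 fun h => hne ((hU.2 hW.1 h).antisymm h)
  -- The common element `x` makes both differences proper subsets, so each has cut degree at least
  -- `k`, while posimodularity bounds their sum by `2 * (k - 1)`.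
  have h₃ := le_cutDegree_of_ssubset hU h₁
    ⟨Set.sdiff_subset, fun h => (h hxU).2 hxW⟩
  have h₄ := le_cutDegree_of_ssubset hW h₂
    ⟨Set.sdiff_subset, fun h => (h hxW).2 hxU⟩
  have h₅ := cutDegree_sdiff_add_cutDegree_sdiff_le G U W
  have h₆ := hU.1.2.2
  have h₇ := hW.1.2.2
  omega

/-- The least elements of the minimal deficient sets. -/
def leaders (k : ℕ) (G : SimpleGraph (Fin n)) : Set (Fin n) :=
  {v | ∃ U, Minimal (IsDeficient k G) U ∧ IsLeast U v}

/-- The least elements of the minimal deficient sets with at most `s` elements. -/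
def smallLeaders (k s : ℕ) (G : SimpleGraph (Fin n)) : Set (Fin n) :=
  {v | ∃ U, Minimal (IsDeficient k G) U ∧ U.ncard ≤ s ∧ IsLeast U v}

theorem smallLeaders_subset_leaders {s : ℕ} : smallLeaders k s G ⊆ leaders k G :=
  fun _ ⟨U, hU, _, hv⟩ => ⟨U, hU, hv⟩

theorem exists_mem_leaders {U : Set (Fin n)} (h : IsDeficient k G U) :
    ∃ v ∈ U, v ∈ leaders k G := by
  obtain ⟨W, hWU, hW⟩ := h.exists_minimal
  obtain ⟨v, hvW, hv⟩ := Set.exists_min_image W id (Set.toFinite W) hW.1.1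
  exact ⟨v, hWU hvW, W, hW, hvW, hv⟩

/-! ### Leaders and the edit distance -/

theorem ncard_adj_eq_two_mul (K : SimpleGraph (Fin n)) :
    {p : Fin n × Fin n | K.Adj p.1 p.2}.ncard = 2 * K.edgeSet.ncard := by
  classical
  rw [← SimpleGraph.coe_edgeFinset, Set.ncard_coe_finset, ← K.sum_degrees_eq_twice_card_edges,
    Set.ncard_eq_toFinset_card', Set.toFinset_ofPred, Finset.card_filter,
    Fintype.sum_prod_type]
  refine Finset.sum_congr rfl fun x _ => ?_
  rw [← Finset.card_filter, ← SimpleGraph.card_neighborFinset_eq_degree]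
  congr 1
  ext y
  simp

/-- Every minimal deficient set is the origin of a missing edge. -/
theorem ncard_leaders_le (hG' : G' ∈ kEdgeConnectivity k n) :
    (leaders k G).ncard ≤ 2 * (symmDiff G.edgeSet G'.edgeSet).ncard := by
  classical
  -- The new edge is oriented so that it starts in the set; by disjointness its origin then
  -- determines the set. An edge has two orientations, whence the factor 2.
  have key : ∀ v : leaders k G, ∃ p : Fin n × Fin n, (G' \ G).Adj p.1 p.2 ∧
      ∃ U, Minimal (IsDeficient k G) U ∧ IsLeast U v ∧ p.1 ∈ U := by
    rintro ⟨v, U, hU, hv⟩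
    have h₁ : cutDegree G U < cutDegree G' U := hU.1.2.2.trans_le (hG' U hU.1.1 hU.1.2.1)
    obtain ⟨p, hp, hp'⟩ : ∃ p ∈ {p : Fin n × Fin n | p.1 ∈ U ∧ p.2 ∉ U ∧ G'.Adj p.1 p.2},
        p ∉ {p : Fin n × Fin n | p.1 ∈ U ∧ p.2 ∉ U ∧ G.Adj p.1 p.2} := by
      by_contra! h
      exact h₁.not_ge (Set.ncard_le_ncard h (Set.toFinite _))
    refine ⟨p, ?_, U, hU, hv, hp.1⟩
    rw [SimpleGraph.sdiff_adj]
    exact ⟨hp.2.2, fun h => hp' ⟨hp.1, hp.2.1, h⟩⟩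
  choose f hf U hU hv hfU using key
  have hinj : Function.Injective f := by
    intro v w h
    have := minimal_isDeficient_unique (hU v) (hU w) (hfU v) (h ▸ hfU w)
    exact Subtype.ext ((hv v).unique (this ▸ hv w))
  calc (leaders k G).ncard = (Set.range f).ncard := by
        rw [← Set.image_univ, Set.ncard_image_of_injective _ hinj, Set.ncard_univ]
        rfl
    _ ≤ {p : Fin n × Fin n | (G' \ G).Adj p.1 p.2}.ncard :=
        Set.ncard_le_ncard (by rintro _ ⟨v, rfl⟩; exact hf v) (Set.toFinite _)
    _ = 2 * (G' \ G).edgeSet.ncard := ncard_adj_eq_two_mul _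
    _ ≤ _ := by
        refine Nat.mul_le_mul_left 2 (Set.ncard_le_ncard ?_ (Set.toFinite _))
        rw [SimpleGraph.edgeSet_sdiff]
        exact fun e he => Or.inr he

/-- Large minimal deficient sets are few. -/
theorem ncard_leaders_le_add (s : ℕ) :
    (s + 1) * (leaders k G).ncard ≤ (s + 1) * (smallLeaders k s G).ncard + n := by
  classical
  have h₁ : (leaders k G).ncard ≤ (smallLeaders k s G).ncard +
      (leaders k G \ smallLeaders k s G).ncard := by
    rw [add_comm]
    exact (Set.ncard_sdiff_add_ncard_of_subset smallLeaders_subset_leaders (Set.toFinite _)).ge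
  have h₂ : (s + 1) * (leaders k G \ smallLeaders k s G).ncard ≤ n := by
    have key : ∀ v ∈ leaders k G \ smallLeaders k s G, ∃ U : Set (Fin n),
        Minimal (IsDeficient k G) U ∧ s + 1 ≤ U.ncard ∧ IsLeast U v := by
      rintro v ⟨⟨U, hU, hv⟩, hs⟩
      refine ⟨U, hU, ?_, hv⟩
      by_contra! h
      exact hs ⟨U, hU, by omega, hv⟩
    choose! U hU hs hv using key
    set S := (leaders k G \ smallLeaders k s G).toFinset with hS
    have hSm : ∀ v ∈ S, v ∈ leaders k G \ smallLeaders k s G := fun v h => by simpa [hS] using h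
    have hdisj : (S : Set (Fin n)).PairwiseDisjoint fun v => (U v).toFinset := by
      intro v hv' w hw hvw
      rw [Function.onFun, Finset.disjoint_left]
      intro x hx hx'
      have hvS := hSm v hv'
      have hwS := hSm w hw
      have := minimal_isDeficient_unique (hU v hvS) (hU w hwS) (by simpa using hx) (by simpa using hx')
      exact hvw ((hv v hvS).unique (this ▸ hv w hwS))
    calc (s + 1) * (leaders k G \ smallLeaders k s G).ncard = ∑ v ∈ S, (s + 1) := by
          rw [Set.ncard_eq_toFinset_card', Finset.sum_const, smul_eq_mul, mul_comm]
      _ ≤ ∑ v ∈ S, ((U v).toFinset).card := Finset.sum_le_sum fun v h => by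
          rw [← Set.ncard_eq_toFinset_card']; exact hs v (hSm v h)
      _ = (S.biUnion fun v => (U v).toFinset).card := (Finset.card_biUnion hdisj).symm
      _ ≤ n := (Finset.card_le_univ _).trans_eq (Fintype.card_fin n)
  nlinarith

/-- The join of a clique `S` with the vertices of `T`. -/
def hubGraph (S T : Set (Fin n)) : SimpleGraph (Fin n) :=
  SimpleGraph.fromRel fun x y => x ∈ S ∧ y ∈ S ∪ T

theorem ncard_edgeSet_hubGraph_le (S T : Set (Fin n)) :
    (hubGraph S T).edgeSet.ncard ≤ S.ncard * (S ∪ T).ncard := by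
  rw [← Set.ncard_prod]
  refine (Set.ncard_le_ncard ?_ (Set.toFinite _)).trans
    (Set.ncard_image_le (f := fun p : Fin n × Fin n => s(p.1, p.2)) (Set.toFinite _))
  intro e
  induction e with | _ x y => ?_
  rw [SimpleGraph.mem_edgeSet, hubGraph, SimpleGraph.fromRel_adj]
  rintro ⟨-, h | h⟩
  · exact ⟨(x, y), h, rfl⟩
  · exact ⟨(y, x), h, Sym2.eq_swap⟩

/-- Each hub yields a cut edge: to `y` if it lies in `U`, and to `x` otherwise. Two of these edges
coincide only if `x` and `y` are both among the hubs used and both yield the pair `(x, y)`; the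
spare vertex `w` compensates for this loss. -/
theorem le_cutDegree_hubGraph {S T : Set (Fin n)} (hS : S.ncard = k) {w : Fin n} (hwT : w ∈ T)
    (hwS : w ∉ S) {U : Set (Fin n)} {x y : Fin n} (hx : x ∈ T) (hy : y ∈ T) (hxU : x ∈ U)
    (hyU : y ∉ U) : k ≤ cutDegree (hubGraph S T) U := by
  classical
  set f : Fin n → Fin n × Fin n := fun z => if z ∈ U then (z, y) else (x, z) with hf
  have adj : ∀ z ∈ U, ∀ z' ∉ U, (z ∈ S ∧ (z' ∈ S ∨ z' ∈ T)) ∨ (z' ∈ S ∧ (z ∈ S ∨ z ∈ T)) →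
      (hubGraph S T).Adj z z' := by
    intro z hz z' hz' h
    rw [hubGraph, SimpleGraph.fromRel_adj]
    exact ⟨fun e => hz' (e ▸ hz), h⟩
  obtain ⟨J, hJ, hJf, hJxy⟩ : ∃ J : Set (Fin n), J.ncard = k ∧
      (∀ z ∈ J, (f z).1 ∈ U ∧ (f z).2 ∉ U ∧ (hubGraph S T).Adj (f z).1 (f z).2) ∧
      ¬ (x ∈ J ∧ y ∈ J) := by
    have hfS : ∀ z ∈ S, (f z).1 ∈ U ∧ (f z).2 ∉ U ∧ (hubGraph S T).Adj (f z).1 (f z).2 := by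
      intro z hz
      by_cases hzU : z ∈ U
      · simp only [hf, hzU, if_true]
        exact ⟨trivial, hyU, adj z hzU y hyU (Or.inl ⟨hz, Or.inr hy⟩)⟩
      · simp only [hf, hzU, if_false]
        exact ⟨hxU, not_false, adj x hxU z hzU (Or.inr ⟨hz, Or.inr hx⟩)⟩
    by_cases hxy : x ∈ S ∧ y ∈ S
    -- Here `x` and `y` are hubs, hence adjacent to `w`, which can replace `y` as a source of a cut
    -- edge.
    · refine ⟨insert w (S \ {y}), ?_, ?_, ?_⟩
      · rw [Set.ncard_insert_of_notMem (fun h => hwS h.1) (Set.toFinite _),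
          Set.ncard_sdiff_singleton_add_one hxy.2 (Set.toFinite _), hS]
      · rintro z (rfl | hz)
        · by_cases hzU : z ∈ U
          · simp only [hf, hzU, if_true]
            exact ⟨trivial, hyU, adj z hzU y hyU (Or.inr ⟨hxy.2, Or.inr hwT⟩)⟩
          · simp only [hf, hzU, if_false]
            exact ⟨hxU, not_false, adj x hxU z hzU (Or.inl ⟨hxy.1, Or.inr hwT⟩)⟩
        · exact hfS z hz.1
      · rintro ⟨-, rfl | h⟩
        · exact hwS hxy.2
        · exact h.2 rfl
    · exact ⟨S, hS, hfS, hxy⟩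
  have hinj : Set.InjOn f J := by
    intro z hz z' hz' h
    simp only [hf] at h
    split_ifs at h with h₁ h₂ h₂
    · exact (Prod.ext_iff.1 h).1
    · obtain ⟨rfl, rfl⟩ := Prod.ext_iff.1 h
      exact absurd ⟨hz, hz'⟩ hJxy
    · obtain ⟨rfl, rfl⟩ := Prod.ext_iff.1 h
      exact absurd ⟨hz', hz⟩ hJxy
    · exact (Prod.ext_iff.1 h).2
  rw [← hJ, ← hinj.ncard_image]
  refine Set.ncard_le_ncard ?_ (Set.toFinite _)
  rintro _ ⟨z, hz, rfl⟩
  exact hJf z hz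

/-- A graph becomes `k`-edge-connected when its leaders are joined to `k` hubs. -/
theorem exists_kEdgeConnected_of_lt (G : SimpleGraph (Fin n)) (hn : k < n) :
    ∃ G' ∈ kEdgeConnectivity k n,
      (symmDiff G.edgeSet G'.edgeSet).ncard ≤ k * (leaders k G).ncard + k * (k + 1) := by
  classical
  set S : Set (Fin n) := {v | v.val < k}
  have hS : S.ncard = k := by
    rw [Set.ncard_eq_toFinset_card', Set.toFinset_ofPred, ← Fintype.card_subtype,
      Fintype.card_congr (Fin.castLEquiv hn.le).symm]
    simp
  set w : Fin n := ⟨k, hn⟩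
  refine ⟨G ⊔ hubGraph S (insert w (leaders k G)), ?_, ?_⟩
  · rw [mem_kEdgeConnectivity_iff]
    intro U hU
    have hU' : IsDeficient k G U := ⟨hU.1, hU.2.1, (cutDegree_mono le_sup_left U).trans_lt hU.2.2⟩
    obtain ⟨x, hxU, hx⟩ := exists_mem_leaders hU'
    obtain ⟨y, hyU, hy⟩ := exists_mem_leaders hU'.compl
    have h₁ := le_cutDegree_hubGraph (k := k) (S := S) (T := insert w (leaders k G)) hS
      (Set.mem_insert w _) (by simp [S, w]) (Or.inr hx) (Or.inr hy) hxU hyU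
    have h₂ := cutDegree_mono (le_sup_right : _ ≤ G ⊔ hubGraph S (insert w (leaders k G))) U
    have h₃ := hU.2.2
    omega
  · have h₁ : symmDiff G.edgeSet (G ⊔ hubGraph S (insert w (leaders k G))).edgeSet ⊆
        (hubGraph S (insert w (leaders k G))).edgeSet := by
      rw [SimpleGraph.edgeSet_sup]
      rintro e (⟨h, h'⟩ | ⟨h | h, h'⟩)
      · exact absurd (Or.inl h) h'
      · exact absurd h h'
      · exact h
    have h₂ : (S ∪ insert w (leaders k G)).ncard ≤ k + ((leaders k G).ncard + 1) :=
      (Set.ncard_union_le _ _).trans (add_le_add hS.le (Set.ncard_insert_le _ _))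
    calc _ ≤ _ := Set.ncard_le_ncard h₁ (Set.toFinite _)
      _ ≤ _ := ncard_edgeSet_hubGraph_le _ _
      _ ≤ k * (k + ((leaders k G).ncard + 1)) := by rw [hS]; exact Nat.mul_le_mul_left k h₂
      _ = _ := by ring

end Deficient

/-! ### Distances -/

/-- There are finitely many graphs on `Fin n`, so the infimum is attained; an empty property gives
`⊤`, which exceeds every real bound. -/
theorem isClose_iff {n m : ℕ} {ε : ℝ} (hm : 0 < m) (hε : 0 ≤ ε) {G : SimpleGraph (Fin n)}
    {P : GraphProperty} :
    IsClose m ε G P ↔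
      ∃ G' ∈ P n, ((symmDiff G.edgeSet G'.edgeSet).ncard : ℝ) ≤ ε * m := by
  have hdist : ∀ G' : SimpleGraph (Fin n), graphDist m G G' ≤ ENNReal.ofReal ε ↔
      ((symmDiff G.edgeSet G'.edgeSet).ncard : ℝ) ≤ ε * m := by
    intro G'
    rw [graphDist, ENNReal.div_le_iff (by exact_mod_cast hm.ne') (ENNReal.natCast_ne_top m),
      ← ENNReal.ofReal_natCast m, ← ENNReal.ofReal_mul hε, ← ENNReal.ofReal_natCast,
      ENNReal.ofReal_le_ofReal_iff (by positivity)]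
  rw [IsClose, distToProperty, iInf_subtype']
  constructor
  · intro h
    rcases isEmpty_or_nonempty {G' // G' ∈ P n} with hP | hP
    · rw [iInf_of_empty, top_le_iff] at h
      exact absurd h ENNReal.ofReal_ne_top
    · obtain ⟨G', hG'⟩ := exists_eq_ciInf_of_finite (f := fun i : {G' // G' ∈ P n} => graphDist m G i)
      exact ⟨G', G'.2, (hdist G').1 (hG'.trans_le h)⟩
  · rintro ⟨G', hG', h⟩
    exact (iInf_le _ (⟨G', hG'⟩ : {G' // G' ∈ P n})).trans ((hdist G').2 h)

/-! ### Local exploration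

A history is a function `H : ℕ → ℕ`. Its first `R` entries are the roots, and entry `R + i * D + j`
(with `j < D`) is the `j`-th neighbor of entry `i`. Entry `z` is the number which signals that there
is no such neighbor. -/

section Exploration

/-- The number of pairs in a cut that a history displays. -/
def outCount (H : ℕ → ℕ) (z R D : ℕ) (I : Finset ℕ) : ℕ :=
  ((I ×ˢ Finset.range D).filter fun p =>
    H (R + p.1 * D + p.2) ≠ H z ∧ ∀ i ∈ I, H i ≠ H (R + p.1 * D + p.2)).card

/-- The history displays a minimal deficient set with least element `H r`. -/
def DisplaysLeader (H : ℕ → ℕ) (z R D k s M r : ℕ) : Prop :=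
  ∃ I : Finset ℕ, I ⊆ Finset.range M ∧ r ∈ I ∧ I.card ≤ s ∧ Set.InjOn H I ∧
    (∀ i ∈ I, H i ≠ H z) ∧ outCount H z R D I < k ∧
    (∀ J ⊆ I, J.Nonempty → J ≠ I → k ≤ outCount H z R D J) ∧ ∀ i ∈ I, H r ≤ H i

/-- A bound on the positions of the vertices at distance at most `d` from the roots. -/
def layerBound (R D : ℕ) : ℕ → ℕ
  | 0 => R
  | d + 1 => R + layerBound R D d * D

theorem layerBound_le_succ (R D d : ℕ) : layerBound R D d ≤ layerBound R D (d + 1) := by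
  induction d with
  | zero => exact Nat.le_add_right _ _
  | succ d ih => exact Nat.add_le_add_left (Nat.mul_le_mul_right D ih) R

theorem le_layerBound (R D d : ℕ) : R ≤ layerBound R D d := by
  cases d with
  | zero => exact le_rfl
  | succ d => exact Nat.le_add_right _ _

theorem position_lt {R D M i j : ℕ} (hi : i < M) (hj : j < D) : R + i * D + j < R + M * D := by
  have : (i + 1) * D ≤ M * D := Nat.mul_le_mul_right D hi
  rw [add_mul, one_mul] at this
  omega

variable {n : ℕ} {G : SimpleGraph (Fin n)} {k : ℕ}

/-! ### Neighbor answers, and what a history certifies -/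

theorem NeighborOracle.neighborAnswer_eq_iff (O : NeighborOracle G) {x y : Fin n} {j : ℕ} :
    O.neighborAnswer x j = y ↔ ∃ h : j < (O.nbrs x).length, (O.nbrs x)[j] = y := by
  simp only [neighborAnswer, x.2, dif_pos, Fin.eta]
  constructor
  · intro h
    by_cases hj : j < (O.nbrs x).length
    · refine ⟨hj, Fin.ext ?_⟩
      rwa [List.getD_eq_getElem _ _ (by simpa using hj), List.getElem_map] at h
    · rw [List.getD_eq_default _ _ (by simpa using hj)] at h
      exact absurd h.symm y.2.ne
  · rintro ⟨hj, rfl⟩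
    rw [List.getD_eq_getElem _ _ (by simpa using hj), List.getElem_map]

theorem NeighborOracle.neighborAnswer_lt_or_eq (O : NeighborOracle G) (v j : ℕ) :
    O.neighborAnswer v j < n ∨ O.neighborAnswer v j = n := by
  unfold neighborAnswer
  split_ifs with h
  · by_cases hj : j < (O.nbrs ⟨v, h⟩).length
    · rw [List.getD_eq_getElem _ _ (by simpa using hj), List.getElem_map]
      exact Or.inl (Fin.is_lt _)
    · exact Or.inr (List.getD_eq_default _ _ (by simpa using hj))
  · exact Or.inr rfl

theorem NeighborOracle.adj_iff (O : NeighborOracle G) {x y : Fin n} :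
    G.Adj x y ↔ ∃ j, O.neighborAnswer x j = y := by
  rw [← O.mem_nbrs, List.mem_iff_getElem]
  simp only [O.neighborAnswer_eq_iff]

theorem NeighborOracle.eq_of_neighborAnswer_eq (O : NeighborOracle G) {x y : Fin n} {j j' : ℕ}
    (h : O.neighborAnswer x j = y) (h' : O.neighborAnswer x j' = y) : j = j' := by
  obtain ⟨hj, h⟩ := O.neighborAnswer_eq_iff.1 h
  obtain ⟨hj', h'⟩ := O.neighborAnswer_eq_iff.1 h'
  exact (O.nodup x).getElem_inj_iff.1 (h.trans h'.symm)

variable {O : NeighborOracle G} {H : ℕ → ℕ} {z R s M : ℕ}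

theorem cutDegree_eq_ncard_image (U : Set (Fin n)) :
    cutDegree G U = ((fun p : Fin n × Fin n => (p.1.val, p.2.val)) ''
      {p | p.1 ∈ U ∧ p.2 ∉ U ∧ G.Adj p.1 p.2}).ncard := by
  rw [Set.ncard_image_of_injective _ fun p q h => by
    obtain ⟨h₁, h₂⟩ := Prod.ext_iff.1 h
    exact Prod.ext (Fin.ext h₁) (Fin.ext h₂)]
  rfl

/-- Only the first `D` neighbors are visible, so the two counts may differ; the choice `D = s + k`
makes them agree on being below `k`. A vertex with a hidden neighbor shows `s + k` distinct
neighbors, of which at most `s` lie in `U`, so at least `k` cut edges are already displayed. -/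
theorem outCount_lt_iff {D : ℕ} (hz : H z = n)
    (hstep : ∀ i < M, ∀ j < D, H (R + i * D + j) = O.neighborAnswer (H i) j)
    (hD : D = s + k) {I : Finset ℕ} (hIM : I ⊆ Finset.range M) (hIs : I.card ≤ s)
    (hinj : Set.InjOn H I) (hIn : ∀ i ∈ I, H i < n) {U : Set (Fin n)}
    (hU : ∀ u, u ∈ U ↔ ∃ i ∈ I, H i = u) :
    outCount H z R D I < k ↔ cutDegree G U < k := by
  set F := (I ×ˢ Finset.range D).filter fun p =>
    H (R + p.1 * D + p.2) ≠ H z ∧ ∀ i ∈ I, H i ≠ H (R + p.1 * D + p.2) with hF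
  set g : ℕ × ℕ → ℕ × ℕ := fun p => (H p.1, H (R + p.1 * D + p.2)) with hg
  have hmem : ∀ p ∈ F, p.1 ∈ I ∧ p.2 < D ∧ ∃ x y : Fin n, x ∈ U ∧ y ∉ U ∧ H p.1 = x ∧
      H (R + p.1 * D + p.2) = y ∧ O.neighborAnswer x p.2 = y := by
    intro p hp
    rw [hF, Finset.mem_filter, Finset.mem_product, Finset.mem_range, hz] at hp
    obtain ⟨⟨hpI, hpD⟩, hpn, hpU⟩ := hp
    have h₁ := hstep p.1 (Finset.mem_range.1 (hIM hpI)) p.2 hpD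
    have h₂ : H (R + p.1 * D + p.2) < n := by
      rcases O.neighborAnswer_lt_or_eq (H p.1) p.2 with h | h
      · rwa [h₁]
      · exact absurd (h₁.trans h) hpn
    refine ⟨hpI, hpD, ⟨_, hIn _ hpI⟩, ⟨_, h₂⟩, (hU _).2 ⟨_, hpI, rfl⟩, fun h => ?_, rfl, rfl,
      h₁.symm⟩
    obtain ⟨i, hi, hi'⟩ := (hU _).1 h
    exact hpU i hi hi'
  have hginj : Set.InjOn g F := by
    intro p hp q hq h
    obtain ⟨h₁, h₂⟩ := Prod.ext_iff.1 h
    obtain ⟨hpI, -, x, y, -, -, hx, hy, hxy⟩ := hmem p hp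
    obtain ⟨hqI, -, x', y', -, -, hx', hy', hxy'⟩ := hmem q hq
    obtain rfl : x = x' := Fin.ext (hx.symm.trans (h₁.trans hx'))
    obtain rfl : y = y' := Fin.ext (hy.symm.trans (h₂.trans hy'))
    exact Prod.ext (hinj hpI hqI h₁) (O.eq_of_neighborAnswer_eq hxy hxy')
  have hcard : outCount H z R D I = (g '' F).ncard := by
    rw [hginj.ncard_image, Set.ncard_coe_finset]
    rfl
  have hsub : g '' F ⊆ (fun p : Fin n × Fin n => (p.1.val, p.2.val)) ''
      {p | p.1 ∈ U ∧ p.2 ∉ U ∧ G.Adj p.1 p.2} := by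
    rintro _ ⟨p, hp, rfl⟩
    obtain ⟨-, -, x, y, hxU, hyU, hx, hy, hxy⟩ := hmem p hp
    exact ⟨(x, y), ⟨hxU, hyU, O.adj_iff.2 ⟨_, hxy⟩⟩, Prod.ext hx.symm hy.symm⟩
  rw [cutDegree_eq_ncard_image]
  constructor
  · intro h
    refine (Set.ncard_le_ncard ?_ (Set.toFinite _)).trans_lt (hcard ▸ h)
    rintro _ ⟨⟨x, y⟩, ⟨hxU, hyU, hxy⟩, rfl⟩
    obtain ⟨i, hi, hix⟩ := (hU x).1 hxU
    obtain ⟨j, hj⟩ := O.adj_iff.1 hxy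
    have hiM := Finset.mem_range.1 (hIM hi)
    by_cases hjD : j < D
    · have h₁ : H (R + i * D + j) = y := by rw [hstep i hiM j hjD, hix, hj]
      refine ⟨(i, j), ?_, Prod.ext hix h₁⟩
      rw [hF, Finset.mem_coe, Finset.mem_filter, Finset.mem_product, Finset.mem_range, hz, h₁]
      exact ⟨⟨hi, hjD⟩, y.2.ne, fun i' hi' h => hyU ((hU y).2 ⟨i', hi', h⟩)⟩
    · exfalso
      obtain ⟨hjl, -⟩ := O.neighborAnswer_eq_iff.1 hj
      have hval : ∀ j' < D, ∃ w : Fin n, H (R + i * D + j') = w ∧ O.neighborAnswer x j' = w := by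
        intro j' hj'
        have := O.neighborAnswer_eq_iff.2 ⟨(hj'.trans_le (not_lt.1 hjD)).trans hjl, rfl⟩
        exact ⟨_, by rw [hstep i hiM j' hj', hix, this], this⟩
      -- The visible neighbors of `x` are split into those outside `U`, which are counted by `F`,
      -- and those inside, which are distinct elements of `I.image H`.
      have h₁ : (Finset.range D).card ≤ F.card + (I.image H).card := by
        rw [← Finset.card_filter_add_card_filter_not (s := Finset.range D)
          fun j' => H (R + i * D + j') ∈ I.image H, add_comm]
        refine add_le_add ?_ ?_
        · refine Finset.card_le_card_of_injOn (fun j' => (i, j')) ?_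
            (fun a _ b _ h => (Prod.ext_iff.1 h).2)
          intro j' hj'
          rw [Finset.mem_coe, Finset.mem_filter, Finset.mem_range] at hj'
          obtain ⟨w, hw, -⟩ := hval j' hj'.1
          rw [hF, Finset.mem_coe, Finset.mem_filter, Finset.mem_product, Finset.mem_range]
          refine ⟨⟨hi, hj'.1⟩, ?_, fun i' hi' h => hj'.2 (Finset.mem_image.2 ⟨i', hi', h⟩)⟩
          simp only [hz, hw]
          exact w.2.ne
        · refine Finset.card_le_card_of_injOn (fun j' => H (R + i * D + j')) ?_ ?_
          · intro j' hj'
            exact (Finset.mem_filter.1 hj').2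
          · intro a ha b hb hab
            rw [Finset.mem_coe, Finset.mem_filter, Finset.mem_range] at ha hb
            obtain ⟨w, hw, hw'⟩ := hval a ha.1
            obtain ⟨w', hv, hv'⟩ := hval b hb.1
            obtain rfl : w = w' := Fin.ext (hw.symm.trans (hab.trans hv))
            exact O.eq_of_neighborAnswer_eq hw' hv'
      have h₂ : (I.image H).card ≤ I.card := Finset.card_image_le
      have h₃ : F.card < k := h
      rw [Finset.card_range] at h₁
      omega
  · intro h
    rw [hcard]
    exact (Set.ncard_le_ncard hsub (Set.toFinite _)).trans_lt h

/-- At most `s` neighbors lie inside `U` and fewer than `k` outside, so `s + k` visible positions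
show the whole list. -/
theorem length_nbrs_lt {U : Set (Fin n)} (O : NeighborOracle G) (hUs : U.ncard ≤ s)
    (hUk : cutDegree G U < k) {x : Fin n} (hx : x ∈ U) : (O.nbrs x).length < s + k := by
  classical
  have h₁ : (O.nbrs x).length = (O.nbrs x).toFinset.card :=
    (List.toFinset_card_of_nodup (O.nodup x)).symm
  rw [h₁, ← Finset.card_filter_add_card_filter_not (s := (O.nbrs x).toFinset) fun y => y ∈ U]
  have h₂ : ((O.nbrs x).toFinset.filter fun y => y ∈ U).card ≤ U.ncard := by
    rw [← Set.ncard_coe_finset]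
    exact Set.ncard_le_ncard (fun y hy => (Finset.mem_filter.1 hy).2) (Set.toFinite _)
  have h₃ : ((O.nbrs x).toFinset.filter fun y => ¬ y ∈ U).card ≤ cutDegree G U := by
    rw [← Set.ncard_coe_finset, ← Set.ncard_image_of_injective _ (Prod.mk_right_injective x)]
    refine Set.ncard_le_ncard ?_ (Set.toFinite _)
    rintro _ ⟨y, hy, rfl⟩
    rw [Finset.mem_coe, Finset.mem_filter, List.mem_toFinset, O.mem_nbrs] at hy
    exact ⟨hx, hy.2, hy.1⟩
  omega

/-- Minimal deficient sets are connected, hence explored. -/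
theorem exists_position_of_minimal {D : ℕ} (hD : D = s + k)
    (hstep : ∀ i < layerBound R D s, ∀ j < D, H (R + i * D + j) = O.neighborAnswer (H i) j)
    {U : Set (Fin n)} (hU : Minimal (IsDeficient k G) U) (hUs : U.ncard ≤ s) {r : ℕ} (hr : r < R)
    {v : Fin n} (hv : v ∈ U) (hrv : H r = v) : ∀ u ∈ U, ∃ i < layerBound R D s, H i = u := by
  set A : ℕ → Set (Fin n) := fun d => {u | u ∈ U ∧ ∃ i < layerBound R D d, H i = u} with hA
  have hAU : ∀ d, A d ⊆ U := fun d u hu => hu.1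
  have hmono : ∀ d, A d ⊆ A (d + 1) := fun d u ⟨hu, i, hi, hiu⟩ =>
    ⟨hu, i, hi.trans_le (layerBound_le_succ R D d), hiu⟩
  have hvA : ∀ d, v ∈ A d := fun d => ⟨hv, r, hr.trans_le (le_layerBound R D d), hrv⟩
  have key : ∀ d ≤ s, A d = U ∨ d + 1 ≤ (A d).ncard := by
    intro d
    induction d with
    | zero =>
      intro _
      right
      rw [zero_add]
      exact (Set.ncard_pos (Set.toFinite _)).2 ⟨v, hvA 0⟩
    | succ d ih =>
      intro hd
      rcases ih (by omega) with h | h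
      · exact Or.inl ((hAU _).antisymm (h ▸ hmono d))
      by_cases hdU : A d = U
      · exact Or.inl ((hAU _).antisymm (hdU ▸ hmono d))
      right
      -- Otherwise every edge leaving `A d` also leaves `U`, giving `A d` fewer than `k` cut edges
      -- against the minimality of `U`. So each layer gains a vertex, and `s` layers exhaust `U`.
      obtain ⟨x, hx, y, hyU, hyA, hxy⟩ : ∃ x ∈ A d, ∃ y ∈ U, y ∉ A d ∧ G.Adj x y := by
        by_contra! hno
        have h₁ := le_cutDegree_of_ssubset hU ⟨v, hvA d⟩ ((hAU d).ssubset_of_ne hdU)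
        have h₂ : cutDegree G (A d) ≤ cutDegree G U :=
          Set.ncard_le_ncard (fun p hp => ⟨hAU d hp.1,
            fun h => hno p.1 hp.1 p.2 h hp.2.1 hp.2.2, hp.2.2⟩) (Set.toFinite _)
        have h₃ := hU.1.2.2
        omega
      obtain ⟨hxU, i, hi, hix⟩ := hx
      obtain ⟨j, hj⟩ := O.adj_iff.1 hxy
      have hjD : j < D := by
        have h₁ := length_nbrs_lt O hUs hU.1.2.2 hxU
        have h₂ := (O.neighborAnswer_eq_iff.1 hj).1
        omega
      have hi' : i < layerBound R D s :=
        hi.trans_le ((monotone_nat_of_le_succ (layerBound_le_succ R D)) (by omega : d ≤ s))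
      have hyA' : y ∈ A (d + 1) :=
        ⟨hyU, R + i * D + j, position_lt hi hjD, by rw [hstep i hi' j hjD, hix, hj]⟩
      have h₁ : (A d).ncard < (A (d + 1)).ncard :=
        Set.ncard_lt_ncard ⟨hmono d, fun h => hyA (h hyA')⟩ (Set.toFinite _)
      omega
  rcases key s le_rfl with h | h
  · intro u hu
    rw [← h] at hu
    exact hu.2
  · have := Set.ncard_le_ncard (hAU s) (Set.toFinite _)
    omega

/-- Index sets on which `H` is injective correspond to explored vertex sets, and `outCount_lt_iff`
transfers deficiency in both directions, for the set itself and for its subsets. The bound `s < n`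
keeps small sets proper. -/
theorem displaysLeader_iff {D : ℕ} (hD : D = s + k) (hz : H z = n) (hsn : s < n)
    (hstep : ∀ i < layerBound R D s, ∀ j < D, H (R + i * D + j) = O.neighborAnswer (H i) j)
    {r : ℕ} (hr : r < R) {v : Fin n} (hrv : H r = v) (hlt : ∀ i < layerBound R D s, H i ≤ n) :
    DisplaysLeader H z R D k s (layerBound R D s) r ↔ v ∈ smallLeaders k s G := by
  classical
  have ne_univ : ∀ {U : Set (Fin n)}, U.ncard ≤ s → U ≠ Set.univ := by
    rintro U hU rfl
    rw [Set.ncard_univ, Nat.card_fin] at hU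
    omega
  have hncard : ∀ {I : Finset ℕ} {U : Set (Fin n)}, Set.InjOn H I →
      (∀ i ∈ I, H i < n) → (∀ u : Fin n, u ∈ U ↔ ∃ i ∈ I, H i = u) → U.ncard = I.card := by
    intro I U hinj hlt hU
    rw [← Set.ncard_image_of_injective U Fin.val_injective, ← Set.ncard_coe_finset,
      ← hinj.ncard_image]
    congr 1
    ext a
    simp only [Set.mem_image, hU, Finset.mem_coe]
    constructor
    · rintro ⟨u, ⟨i, hi, hiu⟩, rfl⟩
      exact ⟨i, hi, hiu⟩
    · rintro ⟨i, hi, rfl⟩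
      exact ⟨⟨_, hlt i hi⟩, ⟨i, hi, rfl⟩, rfl⟩
  constructor
  · rintro ⟨I, hIM, hrI, hIs, hinj, hIn, hIk, hImin, hIle⟩
    have hIlt : ∀ i ∈ I, H i < n := fun i hi =>
      lt_of_le_of_ne (hlt i (Finset.mem_range.1 (hIM hi))) (hz ▸ hIn i hi)
    set U : Set (Fin n) := {u | ∃ i ∈ I, H i = u} with hU
    have hUs : U.ncard ≤ s := (hncard hinj hIlt fun u => Iff.rfl).trans_le hIs
    refine ⟨U, ⟨⟨⟨v, r, hrI, hrv⟩, ne_univ hUs, ?_⟩, ?_⟩, hUs, ⟨r, hrI, hrv⟩, ?_⟩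
    · exact (outCount_lt_iff hz hstep hD hIM hIs hinj hIlt fun u => Iff.rfl).1 hIk
    · intro W hW hWU
      set J := I.filter fun i => ∃ w ∈ W, H i = w.val with hJ
      have hJI : J ⊆ I := Finset.filter_subset _ _
      have hWJ : ∀ u : Fin n, u ∈ W ↔ ∃ i ∈ J, H i = u := by
        intro u
        constructor
        · intro hu
          obtain ⟨i, hi, hiu⟩ := hWU hu
          exact ⟨i, Finset.mem_filter.2 ⟨hi, u, hu, hiu⟩, hiu⟩
        · rintro ⟨i, hi, hiu⟩
          obtain ⟨-, w, hw, hiw⟩ := Finset.mem_filter.1 hi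
          rwa [Fin.ext (hiu.symm.trans hiw)]
      have hJk := (outCount_lt_iff hz hstep hD (hJI.trans hIM)
        ((Finset.card_le_card hJI).trans hIs) (hinj.mono hJI) (fun i hi => hIlt i (hJI hi)) hWJ).2
        hW.2.2
      have hJI' : J = I := by
        by_contra hne
        obtain ⟨w, hw⟩ := hW.1
        obtain ⟨i, hi, -⟩ := (hWJ w).1 hw
        exact hJk.not_ge (hImin J hJI ⟨i, hi⟩ hne)
      rintro u ⟨i, hi, hiu⟩
      exact (hWJ u).2 ⟨i, hJI' ▸ hi, hiu⟩
    · rintro u ⟨i, hi, hiu⟩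
      exact_mod_cast hrv ▸ hiu ▸ hIle i hi
  · rintro ⟨U, hU, hUs, hvU, hvle⟩
    -- A vertex may occur at several positions. One is chosen for each vertex, and the choice is
    -- forced to be `r` for `v`, so that repeated roots are all recognized.
    have key : ∀ u : Fin n, ∃ i, u ∈ U → i < layerBound R D s ∧ H i = u ∧ (u = v → i = r) := by
      intro u
      by_cases huv : u = v
      · subst huv
        exact ⟨r, fun _ => ⟨hr.trans_le (le_layerBound _ _ _), hrv, fun _ => rfl⟩⟩
      · by_cases hu : u ∈ U
        · obtain ⟨i, hi, hiu⟩ := exists_position_of_minimal hD hstep hU hUs hr hvU hrv u hu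
          exact ⟨i, fun _ => ⟨hi, hiu, fun h => absurd h huv⟩⟩
        · exact ⟨0, fun h => absurd h hu⟩
    choose f hf using key
    set I := U.toFinset.image f with hI
    have hImem : ∀ i, i ∈ I ↔ ∃ u ∈ U, f u = i := by simp [hI]
    have hinj : Set.InjOn H I := by
      intro i hi i' hi' h
      obtain ⟨u, hu, rfl⟩ := (hImem i).1 hi
      obtain ⟨u', hu', rfl⟩ := (hImem i').1 hi'
      rw [(hf u hu).2.1, (hf u' hu').2.1] at h
      rw [Fin.ext h]
    have hIlt : ∀ i ∈ I, H i < n := by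
      intro i hi
      obtain ⟨u, hu, rfl⟩ := (hImem i).1 hi
      exact (hf u hu).2.1 ▸ u.2
    have hIU : ∀ u : Fin n, u ∈ U ↔ ∃ i ∈ I, H i = u := by
      intro u
      constructor
      · exact fun hu => ⟨f u, (hImem _).2 ⟨u, hu, rfl⟩, (hf u hu).2.1⟩
      · rintro ⟨i, hi, hiu⟩
        obtain ⟨u', hu', rfl⟩ := (hImem i).1 hi
        rwa [Fin.ext (hiu.symm.trans (hf u' hu').2.1)]
    have hIM : I ⊆ Finset.range (layerBound R D s) := by
      intro i hi
      obtain ⟨u, hu, rfl⟩ := (hImem i).1 hi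
      exact Finset.mem_range.2 (hf u hu).1
    have hIs : I.card ≤ s := (hncard hinj hIlt hIU).symm.trans_le hUs
    refine ⟨I, hIM, (hImem r).2 ⟨v, hvU, (hf v hvU).2.2 rfl⟩, hIs, hinj,
      fun i hi => hz.symm ▸ (hIlt i hi).ne,
      (outCount_lt_iff hz hstep hD hIM hIs hinj hIlt hIU).2 hU.1.2.2, ?_, ?_⟩
    · intro J hJI hJ hne
      by_contra! hJk
      set W : Set (Fin n) := {u | ∃ i ∈ J, H i = u} with hW
      have hWk := (outCount_lt_iff (U := W) hz hstep hD (hJI.trans hIM)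
        ((Finset.card_le_card hJI).trans hIs) (hinj.mono hJI) (fun i hi => hIlt i (hJI hi))
        fun u => Iff.rfl).1 hJk
      have hWU : W ⊂ U := by
        refine ⟨fun u ⟨i, hi, hiu⟩ => (hIU u).2 ⟨i, hJI hi, hiu⟩, fun h => hne ?_⟩
        refine hJI.antisymm fun i hi => ?_
        obtain ⟨i', hi', hii'⟩ := h ((hIU ⟨H i, hIlt i hi⟩).2 ⟨i, hi, rfl⟩)
        rwa [hinj hi (hJI hi') hii'.symm]
      obtain ⟨i, hi⟩ := hJ
      exact hWk.not_ge (le_cutDegree_of_ssubset hU ⟨⟨H i, hIlt i (hJI hi)⟩, i, hi, rfl⟩ hWU)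
    · intro i hi
      obtain ⟨u, hu, rfl⟩ := (hImem i).1 hi
      rw [hrv, (hf u hu).2.1]
      exact hvle hu

end Exploration

/-! ### Lookup tables -/

section Lookup

/-- A function that is constant off a finite set is primitive recursive, whatever its values there;
classically defined quantities thus enter the algorithm as hard-coded tables. -/
theorem primrec_ite_mem_finset {α β : Type*} [Primcodable α] [Primcodable β] [DecidableEq α]
    (S : Finset α) (f : α → β) (d : β) : Primrec fun x => if x ∈ S then f x else d := by
  induction S using Finset.induction_on with
  | empty => simpa using Primrec.const d
  | insert a S _ ih =>
    refine (Primrec.ite (Primrec.eq.comp .id (.const a)) (.const (f a)) ih).of_eq fun x => ?_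
    by_cases h : x = a
    · subst h; simp
    · simp [h]

theorem finite_bounded_lists (L C : ℕ) : {l : List ℕ | l.length ≤ L ∧ ∀ a ∈ l, a ≤ C}.Finite := by
  refine ((List.finite_length_le (Fin (C + 1)) L).image (List.map Fin.val)).subset ?_
  rintro l ⟨hl, hlC⟩
  refine ⟨l.pmap (fun a (h : a ≤ C) => ⟨a, Nat.lt_succ_of_le h⟩) hlC, by simpa using hl, ?_⟩
  rw [List.map_pmap]
  simp

/-- The relative order of the first `N` entries of a list. -/
def comparisons (N : ℕ) (l : List ℕ) : List Bool :=
  (List.range (N * N)).map fun p => decide (l.getD (p / N) 0 ≤ l.getD (p % N) 0)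

theorem primrec_comparisons (N : ℕ) : Primrec (comparisons N) := by
  refine Primrec.list_map (.const _) (PrimrecPred.decide (Primrec.nat_le.comp ?_ ?_))
  · exact (Primrec.list_getD 0).comp .fst (Primrec.nat_div.comp .snd (.const N))
  · exact (Primrec.list_getD 0).comp .fst (Primrec.nat_mod.comp .snd (.const N))

theorem le_iff_of_comparisons_eq {N : ℕ} {l l' : List ℕ} (h : comparisons N l = comparisons N l')
    {i j : ℕ} (hi : i < N) (hj : j < N) :
    l.getD i 0 ≤ l.getD j 0 ↔ l'.getD i 0 ≤ l'.getD j 0 := by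
  have hN : i * N + j < N * N := by
    have : (i + 1) * N ≤ N * N := Nat.mul_le_mul_right N hi
    rw [add_mul, one_mul] at this
    omega
  have h₁ : (i * N + j) / N = i := by
    rw [mul_comm, Nat.mul_add_div (by omega), Nat.div_eq_of_lt hj, add_zero]
  have h₂ : (i * N + j) % N = j := by
    rw [mul_comm, Nat.mul_add_mod, Nat.mod_eq_of_lt hj]
  have h₃ := congrArg (fun t : List Bool => t[i * N + j]?) h
  simpa [comparisons, hN, h₁, h₂] using h₃

/-- Displaying a leader involves only equalities and comparisons between entries at positions below
`N`. This makes a finite table suffice although vertex numbers are unbounded. -/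
theorem displaysLeader_congr {H H' : ℕ → ℕ} {z R D k s M N r : ℕ}
    (h : ∀ i < N, ∀ j < N, H i ≤ H j ↔ H' i ≤ H' j) (hz : z < N) (hR : r < N) (hM : M ≤ N)
    (hN : R + M * D ≤ N) :
    DisplaysLeader H z R D k s M r ↔ DisplaysLeader H' z R D k s M r := by
  have heq : ∀ i < N, ∀ j < N, H i = H j ↔ H' i = H' j := fun i hi j hj => by
    rw [le_antisymm_iff, le_antisymm_iff, h i hi j hj, h j hj i hi]
  have hI : ∀ {I : Finset ℕ}, I ⊆ Finset.range M → ∀ i ∈ I, i < N := fun hIM i hi =>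
    (Finset.mem_range.1 (hIM hi)).trans_le hM
  have hout : ∀ I ⊆ Finset.range M, outCount H z R D I = outCount H' z R D I := by
    intro I hIM
    refine congrArg Finset.card (Finset.filter_congr fun p hp => ?_)
    obtain ⟨hpI, hpD⟩ := Finset.mem_product.1 hp
    have hpN := (position_lt (R := R) (Finset.mem_range.1 (hIM hpI))
      (Finset.mem_range.1 hpD)).trans_le hN
    refine and_congr (not_congr (heq _ hpN _ hz)) (forall₂_congr fun i hi => ?_)
    exact not_congr (heq _ (hI hIM i hi) _ hpN)
  refine exists_congr fun I => and_congr_right fun hIM => and_congr_right fun _ =>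
    and_congr_right fun _ => and_congr ?_ <| and_congr ?_ <| and_congr ?_ <| and_congr ?_ ?_
  · exact forall₂_congr fun i hi => forall₂_congr fun j hj => by
      rw [heq i (hI hIM i hi) j (hI hIM j hj)]
  · exact forall₂_congr fun i hi => not_congr (heq i (hI hIM i hi) z hz)
  · rw [hout I hIM]
  · exact forall₂_congr fun J hJ => by rw [hout J (hJ.trans hIM)]
  · exact forall₂_congr fun i hi => h r hR i (hI hIM i hi)

open Classical in
/-- The number of roots which are displayed as leaders. -/
noncomputable def leaderCount (H : ℕ → ℕ) (z R D k s M : ℕ) : ℕ :=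
  ((Finset.range R).filter fun r => DisplaysLeader H z R D k s M r).card

/-- The number of displayed leaders, as a function of the order of the history. -/
noncomputable def leaderTable (z R D k s M N : ℕ) (t : List Bool) : ℕ :=
  if t ∈ (List.finite_length_eq Bool (N * N)).toFinset then
    leaderCount (fun i => (Function.invFun (comparisons N) t).getD i 0) z R D k s M
  else 0

theorem primrec_leaderTable (z R D k s M N : ℕ) : Primrec (leaderTable z R D k s M N) :=
  primrec_ite_mem_finset _ _ _

/-- The table evaluates the count on an arbitrary list with the given order pattern, which is
harmless since the count depends on the pattern alone. -/
theorem leaderTable_comparisons {z R D k s M N : ℕ} (hz : z < N) (hR : R ≤ N) (hM : M ≤ N)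
    (hN : R + M * D ≤ N) (l : List ℕ) :
    leaderTable z R D k s M N (comparisons N l) =
      leaderCount (fun i => l.getD i 0) z R D k s M := by
  classical
  rw [leaderTable, if_pos (by simp [comparisons])]
  refine congrArg Finset.card (Finset.filter_congr fun r hr => ?_)
  refine displaysLeader_congr (fun i hi j hj => ?_) hz ((Finset.mem_range.1 hr).trans_le hR) hM hN
  exact le_iff_of_comparisons_eq (Function.apply_invFun_apply (f := comparisons N)) hi hj

/-- The graph on `n` vertices whose neighbor lists, padded to length `n`, are the blocks of `h`. -/
def graphOfLists (n : ℕ) (h : List ℕ) : SimpleGraph (Fin n) :=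
  SimpleGraph.fromRel fun u v => ∃ i < n, h.getD (u * n + i) 0 = v

open Classical in
/-- If no graph has the property then `(0, 1)`, and otherwise `(1, d)`, where `d` is the number of
edges by which the graph given by a list differs from the property. -/
noncomputable def editCount (P : GraphProperty) (x : ℕ × List ℕ) : ℕ × ℕ :=
  if (P x.1).Nonempty then
    (1, sInf {d | ∃ G' ∈ P x.1,
      (symmDiff (graphOfLists x.1 x.2).edgeSet G'.edgeSet).ncard = d})
  else (0, 1)

/-- The pair `(0, 1)` encodes an infinite distance: the cross-multiplied inequality then reads `A ≤
0` and fails. -/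
theorem editCount_le_iff {P : GraphProperty} {n : ℕ} {h : List ℕ} {A c : ℕ} (hA : 0 < A) :
    (editCount P (n, h)).2 * A ≤ c * (editCount P (n, h)).1 ↔
      ∃ G' ∈ P n, (symmDiff (graphOfLists n h).edgeSet G'.edgeSet).ncard * A ≤ c := by
  unfold editCount
  split_ifs with hP
  · simp only [mul_one]
    obtain ⟨G₀, hG₀⟩ := hP
    constructor
    · intro hle
      have hne : {d | ∃ G' ∈ P n,
          (symmDiff (graphOfLists n h).edgeSet G'.edgeSet).ncard = d}.Nonempty := ⟨_, G₀, hG₀, rfl⟩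
      obtain ⟨G', hG', hd⟩ := Nat.sInf_mem hne
      exact ⟨G', hG', hd ▸ hle⟩
    · rintro ⟨G', hG', hle⟩
      refine (Nat.mul_le_mul_right A (Nat.sInf_le ?_)).trans hle
      exact ⟨G', hG', rfl⟩
  · simp only [one_mul, mul_zero, Nat.le_zero, hA.ne', false_iff]
    rintro ⟨G', hG', -⟩
    exact hP ⟨G', hG'⟩

theorem finite_adjacency_lists (n₀ : ℕ) :
    {x : ℕ × List ℕ | x.1 ≤ n₀ ∧ x.2.length ≤ n₀ * n₀ ∧ ∀ a ∈ x.2, a ≤ n₀}.Finite :=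
  ((Set.finite_Iic n₀).prod (finite_bounded_lists (n₀ * n₀) n₀)).subset fun _ hx => ⟨hx.1, hx.2⟩

/-- The table of the values of `editCount` for graphs with at most `n₀` vertices. -/
noncomputable def editTable (P : GraphProperty) (n₀ : ℕ) (x : ℕ × List ℕ) : ℕ × ℕ :=
  if x ∈ (finite_adjacency_lists n₀).toFinset then editCount P x else (0, 1)

theorem primrec_editTable (P : GraphProperty) (n₀ : ℕ) : Primrec (editTable P n₀) :=
  primrec_ite_mem_finset _ _ _

end Lookup

/-! ### The algorithm -/

section Algorithm

/-- Read the whole graph, and compare its distance from the property with `B * m / A`. -/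
def readerNext (T : ℕ × List ℕ → ℕ × ℕ) (A B n m : ℕ) (h : List ℕ) : Action :=
  if h.length < n * n then .neighbor (h.length / n) (h.length % n)
  else .halt (decide ((T (n, h)).2 * A ≤ B * m * (T (n, h)).1))

/-- Explore the neighborhoods of `R` random vertices, and compare the fraction of leaders with
`B * m / (A * n)`. -/
def explorerNext (W : List Bool → ℕ) (R D L A B n m : ℕ) (h : List ℕ) : Action :=
  if h.length < R then .draw (n - 1)
  -- An entry equal to `n` is expanded like a vertex; the oracle answers `n` again, so the marker
  -- propagates and the positions stay regular.
  else if h.length < L then .neighbor (h.getD ((h.length - R) / D) 0) ((h.length - R) % D)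
  else .halt (decide (W (comparisons (L + 1) (h ++ [n])) * (A * n) ≤ B * m * R))

/-! ### Computability of the strategies -/

theorem primrec_halt : Primrec Action.halt :=
  (Primrec.of_equiv_symm (e := Action.equivSum)).comp (Primrec.sumInl.comp Primrec.sumInl)

theorem primrec_draw : Primrec Action.draw :=
  (Primrec.of_equiv_symm (e := Action.equivSum)).comp (Primrec.sumInl.comp Primrec.sumInr)

theorem primrec_neighbor : Primrec₂ Action.neighbor :=
  (Primrec.of_equiv_symm (e := Action.equivSum)).comp (Primrec.sumInr.comp Primrec.sumInr)

theorem primrec_readerNext {T : ℕ × List ℕ → ℕ × ℕ} (hT : Primrec T) (A B : ℕ) :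
    Primrec fun x : ℕ × ℕ × List ℕ => readerNext T A B x.1 x.2.1 x.2.2 := by
  have hn : Primrec fun x : ℕ × ℕ × List ℕ => x.1 := .fst
  have hm : Primrec fun x : ℕ × ℕ × List ℕ => x.2.1 := Primrec.fst.comp .snd
  have hh : Primrec fun x : ℕ × ℕ × List ℕ => x.2.2 := Primrec.snd.comp .snd
  have hl := Primrec.list_length.comp hh
  have hTx := hT.comp (hn.pair hh)
  refine Primrec.ite (Primrec.nat_lt.comp hl (Primrec.nat_mul.comp hn hn)) ?_ ?_
  · exact primrec_neighbor.comp (Primrec.nat_div.comp hl hn) (Primrec.nat_mod.comp hl hn)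
  · refine primrec_halt.comp (PrimrecPred.decide (Primrec.nat_le.comp ?_ ?_))
    · exact Primrec.nat_mul.comp (Primrec.snd.comp hTx) (.const A)
    · exact Primrec.nat_mul.comp (Primrec.nat_mul.comp (.const B) hm) (Primrec.fst.comp hTx)

theorem primrec_explorerNext {W : List Bool → ℕ} (hW : Primrec W) (R D L A B : ℕ) :
    Primrec fun x : ℕ × ℕ × List ℕ => explorerNext W R D L A B x.1 x.2.1 x.2.2 := by
  have hn : Primrec fun x : ℕ × ℕ × List ℕ => x.1 := .fst
  have hm : Primrec fun x : ℕ × ℕ × List ℕ => x.2.1 := Primrec.fst.comp .snd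
  have hh : Primrec fun x : ℕ × ℕ × List ℕ => x.2.2 := Primrec.snd.comp .snd
  have hl := Primrec.list_length.comp hh
  have hlR := Primrec.nat_sub.comp hl (.const R)
  refine Primrec.ite (Primrec.nat_lt.comp hl (.const R)) ?_
    (Primrec.ite (Primrec.nat_lt.comp hl (.const L)) ?_ ?_)
  · exact primrec_draw.comp (Primrec.nat_sub.comp hn (.const 1))
  · exact primrec_neighbor.comp
      ((Primrec.list_getD 0).comp hh (Primrec.nat_div.comp hlR (.const D)))
      (Primrec.nat_mod.comp hlR (.const D))
  · refine primrec_halt.comp (PrimrecPred.decide (Primrec.nat_le.comp ?_ ?_))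
    · exact Primrec.nat_mul.comp
        (hW.comp ((primrec_comparisons (L + 1)).comp (Primrec.list_concat.comp hh hn)))
        (Primrec.nat_mul.comp (.const A) hn)
    · exact Primrec.nat_mul.comp (Primrec.nat_mul.comp (.const B) hm) (.const R)

/-- Read the graph if it has at most `n₀` vertices, and explore it otherwise. -/
def sizeSwitch (n₀ : ℕ) (f g : ℕ → ℕ → List ℕ → Action) (n m : ℕ) (h : List ℕ) : Action :=
  if n ≤ n₀ then f n m h else g n m h

theorem primrec_sizeSwitch (n₀ : ℕ) {f g : ℕ → ℕ → List ℕ → Action}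
    (hf : Primrec fun x : ℕ × ℕ × List ℕ => f x.1 x.2.1 x.2.2)
    (hg : Primrec fun x : ℕ × ℕ × List ℕ => g x.1 x.2.1 x.2.2) :
    Primrec fun x : ℕ × ℕ × List ℕ => sizeSwitch n₀ f g x.1 x.2.1 x.2.2 :=
  Primrec.ite (Primrec.nat_le.comp .fst (.const n₀)) hf hg

end Algorithm

/-! ### Output probabilities -/

section Output

/-- The probability of the output `b`. -/
noncomputable def outputProb (μ : PMF (Option (Bool × ℕ))) (b : Bool) : ℝ≥0∞ :=
  μ.map (Option.map Prod.fst) (some b)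

theorem outputProb_map_countQuery (μ : PMF (Option (Bool × ℕ))) (b : Bool) :
    outputProb (μ.map countQuery) b = outputProb μ b := by
  rw [outputProb, PMF.map_comp]
  congr 2
  funext o
  cases o <;> rfl

/-- Turns a bound on the probability of rejection into one on acceptance, for strategies that always
halt. -/
theorem outputProb_true_add_false {μ : PMF (Option (Bool × ℕ))}
    (h : ∀ o ∈ μ.support, ∃ (b : Bool) (c : ℕ), o = some (b, c)) :
    outputProb μ true + outputProb μ false = 1 := by
  have h₁ := (μ.map (Option.map Prod.fst)).tsum_coe
  have h₂ : μ.map (Option.map Prod.fst) none = 0 := by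
    rw [PMF.apply_eq_zero_iff, PMF.mem_support_map_iff]
    rintro ⟨o, ho, ho'⟩
    obtain ⟨b, c, rfl⟩ := h o ho
    cases ho'
  rw [tsum_fintype, Fintype.sum_option, h₂, zero_add, Fintype.sum_bool] at h₁
  exact h₁

variable {n : ℕ} {G : SimpleGraph (Fin n)} (O : NeighborOracle G) {next : List ℕ → Action}

theorem outputProb_run_halt {h : List ℕ} {b' : Bool} (hh : next h = .halt b') (T : ℕ) (b : Bool) :
    outputProb (run O next (T + 1) h) b = if b = b' then 1 else 0 := by
  simp [run, hh, outputProb, PMF.pure_map, PMF.pure_apply]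

theorem outputProb_run_neighbor {h : List ℕ} {v i : ℕ} (hh : next h = .neighbor v i) (T : ℕ)
    (b : Bool) : outputProb (run O next (T + 1) h) b =
      outputProb (run O next T (h ++ [O.neighborAnswer v i])) b := by
  simp only [run, hh, outputProb_map_countQuery]

theorem outputProb_run_draw {h : List ℕ} {N : ℕ} (hh : next h = .draw N) (T : ℕ) (b : Bool) :
    outputProb (run O next (T + 1) h) b =
      ((N + 1 : ℕ) : ℝ≥0∞)⁻¹ * ∑ r ∈ Finset.range (N + 1), outputProb (run O next T (h ++ [r])) b := by
  simp only [run, hh, outputProb, PMF.map_bind]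
  rw [PMF.bind_apply, tsum_fintype, Finset.sum_range, Finset.mul_sum]
  simp only [PMF.uniformOfFintype_apply, Fintype.card_fin]

/-- Every step before halting lengthens the history by one, so its length bounds both the steps and
the queries; one extra step is needed for halting. -/
theorem run_support {L : ℕ} (hnext : ∀ h, L ≤ h.length → ∃ b, next h = .halt b) (T : ℕ) :
    ∀ h : List ℕ, h.length ≤ L → L + 1 ≤ T + h.length → ∀ o ∈ (run O next T h).support,
      ∃ (b : Bool) (c : ℕ), o = some (b, c) ∧ c ≤ L - h.length := by
  induction T with
  | zero => intro h h₁ h₂; omega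
  | succ T ih =>
    intro h h₁ h₂ o ho
    have step : ∀ x, (∀ b, next h ≠ .halt b) → ∀ o ∈ (run O next T (h ++ [x])).support,
        ∃ (b : Bool) (c : ℕ), o = some (b, c) ∧ c + 1 ≤ L - h.length := by
      intro x hx o ho
      have hlt : h.length < L := by
        by_contra! hL
        obtain ⟨b, hb⟩ := hnext h hL
        exact hx b hb
      obtain ⟨b, c, rfl, hc⟩ := ih (h ++ [x]) (by simpa using hlt) (by simp; omega) o ho
      simp only [List.length_append, List.length_singleton] at hc
      exact ⟨b, c, rfl, by omega⟩
    rw [run] at ho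
    split at ho
    · rw [PMF.mem_support_pure_iff] at ho
      exact ⟨_, 0, ho, Nat.zero_le _⟩
    · rename_i heq
      obtain ⟨r, -, hr⟩ := (PMF.mem_support_bind_iff _ _ _).1 ho
      obtain ⟨b, c, rfl, hc⟩ := step _ (by simp [heq]) o hr
      exact ⟨b, c, rfl, by omega⟩
    · rename_i heq
      obtain ⟨o', ho', rfl⟩ := (PMF.mem_support_map_iff _ _ _).1 ho
      obtain ⟨b, c, rfl, hc⟩ := step _ (by simp [heq]) o' ho'
      exact ⟨b, c + 1, rfl, hc⟩
    · rename_i heq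
      obtain ⟨o', ho', rfl⟩ := (PMF.mem_support_map_iff _ _ _).1 ho
      obtain ⟨b, c, rfl, hc⟩ := step _ (by simp [heq]) o' ho'
      exact ⟨b, c + 1, rfl, hc⟩

/-- As long as only neighbor queries are made, the history is determined by the oracle. -/
theorem exists_history {l L : ℕ}
    (hq : ∀ h : List ℕ, l ≤ h.length → h.length < L → ∃ v i, next h = .neighbor v i) (d : ℕ) :
    ∀ h : List ℕ, l ≤ h.length → h.length + d = L →
      ∃ h' : List ℕ, h <+: h' ∧ h'.length = L ∧
        (∀ t, h.length ≤ t → t < L → ∀ v i, next (h'.take t) = .neighbor v i →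
          h'.getD t 0 = O.neighborAnswer v i) ∧
        ∀ T b, outputProb (run O next (T + d) h) b = outputProb (run O next T h') b := by
  induction d with
  | zero =>
    intro h _ hL
    exact ⟨h, List.prefix_rfl, hL, fun t ht ht' => by omega, fun T b => rfl⟩
  | succ d ih =>
    intro h hl hL
    obtain ⟨v, i, hvi⟩ := hq h hl (by omega)
    obtain ⟨h', hpre, hlen, hcons, hrun⟩ := ih (h ++ [O.neighborAnswer v i])
      (by simp; omega) (by simp; omega)
    refine ⟨h', (List.prefix_append _ _).trans hpre, hlen, fun t ht htL v' i' hvi' => ?_,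
      fun T b => ?_⟩
    · rcases ht.eq_or_lt with rfl | ht
      · obtain ⟨r, rfl⟩ := hpre
        have h₁ : ((h ++ [O.neighborAnswer v i]) ++ r).take h.length = h := by simp
        rw [h₁, hvi] at hvi'
        obtain ⟨rfl, rfl⟩ := Action.neighbor.inj hvi'
        simp
      · exact hcons t (by simp; omega) htL v' i' hvi'
    · rw [← add_assoc, outputProb_run_neighbor O hvi, hrun]

/-- Chebyshev's inequality, for the sum of `g` over uniformly drawn vertices. -/
theorem outputProb_run_draws_le {R T : ℕ} {b : Bool} {g : Fin n → ℝ} {ρ : ℝ} (hn : 0 < n)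
    (hρ : 0 ≤ ρ) (hdraw : ∀ h : List ℕ, h.length < R → next h = .draw (n - 1))
    (hg : ∑ v, g v = 0) (hg' : ∑ v, g v ^ 2 ≤ n / 4)
    (hfinal : ∀ l : List (Fin n), l.length = R →
      outputProb (run O next T (l.map Fin.val)) b ≤ ENNReal.ofReal ((l.map g).sum ^ 2 * ρ))
    (r : ℕ) : ∀ l : List (Fin n), l.length + r = R →
      outputProb (run O next (T + r) (l.map Fin.val)) b ≤
        ENNReal.ofReal (((l.map g).sum ^ 2 + r / 4) * ρ) := by
  induction r with
  | zero =>
    intro l hl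
    simpa using hfinal l hl
  | succ r ih =>
    intro l hl
    have hn' : (0 : ℝ) < n := by exact_mod_cast hn
    rw [← add_assoc, outputProb_run_draw O (hdraw _ (by simp; omega)), Nat.sub_add_cancel hn,
      Finset.sum_range]
    set x := (l.map g).sum with hx
    have h₁ : ∀ v : Fin n, outputProb (run O next (T + r) (l.map Fin.val ++ [v.val])) b ≤
        ENNReal.ofReal (((x + g v) ^ 2 + r / 4) * ρ) := by
      intro v
      have := ih (l ++ [v]) (by simp; omega)
      simpa [hx] using this
    -- The cross term vanishes because `g` has mean zero, so each draw adds at most 1/4 to the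
    -- expected square.
    have h₂ : ∑ v, ((x + g v) ^ 2 + r / 4) * ρ ≤ n * ((x ^ 2 + (r + 1 : ℕ) / 4) * ρ) := by
      have : ∑ v, ((x + g v) ^ 2 + r / 4) = n * (x ^ 2 + r / 4) + ∑ v, g v ^ 2 := by
        have : ∀ v, (x + g v) ^ 2 + (r : ℝ) / 4 = (x ^ 2 + r / 4) + 2 * x * g v + g v ^ 2 :=
          fun v => by ring
        simp only [this, Finset.sum_add_distrib, ← Finset.mul_sum, hg]
        simp [mul_add]
      rw [← Finset.sum_mul, this, ← mul_assoc]
      refine mul_le_mul_of_nonneg_right ?_ hρ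
      push_cast
      linarith
    calc _ ≤ ((n : ℕ) : ℝ≥0∞)⁻¹ * ∑ v : Fin n, ENNReal.ofReal (((x + g v) ^ 2 + r / 4) * ρ) := by
          gcongr with v
          exact h₁ v
      _ = ((n : ℕ) : ℝ≥0∞)⁻¹ * ENNReal.ofReal (∑ v, ((x + g v) ^ 2 + r / 4) * ρ) := by
          rw [ENNReal.ofReal_sum_of_nonneg fun v _ => by positivity]
      _ ≤ ((n : ℕ) : ℝ≥0∞)⁻¹ * ENNReal.ofReal (n * ((x ^ 2 + (r + 1 : ℕ) / 4) * ρ)) := by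
          gcongr
      _ = _ := by
          rw [ENNReal.ofReal_mul hn'.le, ENNReal.ofReal_natCast, ← mul_assoc,
            ENNReal.inv_mul_cancel (by exact_mod_cast hn.ne') (ENNReal.natCast_ne_top n), one_mul]

end Output

/-! ### Correctness of the algorithm -/

section Correctness

variable {n : ℕ} {G : SimpleGraph (Fin n)} (O : NeighborOracle G)

theorem NeighborOracle.neighborAnswer_le (v j : ℕ) : O.neighborAnswer v j ≤ n :=
  (O.neighborAnswer_lt_or_eq v j).elim le_of_lt le_of_eq

theorem NeighborOracle.adj_iff_lt {x y : Fin n} :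
    G.Adj x y ↔ ∃ j < n, O.neighborAnswer x j = y := by
  rw [O.adj_iff]
  refine exists_congr fun j => ⟨fun h => ⟨?_, h⟩, fun h => h.2⟩
  refine (O.neighborAnswer_eq_iff.1 h).1.trans_le ?_
  simpa using (O.nodup x).length_le_card

theorem graphOfLists_eq {h : List ℕ}
    (hh : ∀ t < n * n, h.getD t 0 = O.neighborAnswer (t / n) (t % n)) :
    graphOfLists n h = G := by
  have key : ∀ u v : Fin n, (∃ i < n, h.getD (u * n + i) 0 = v) ↔ G.Adj u v := by
    intro u v
    rw [O.adj_iff_lt]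
    refine exists_congr fun i => and_congr_right fun hi => ?_
    have hlt : u * n + i < n * n := by
      have := position_lt (R := 0) u.2 hi
      omega
    have h₁ : (u * n + i) / n = u := by
      rw [mul_comm, Nat.mul_add_div (by omega), Nat.div_eq_of_lt hi, add_zero]
    have h₂ : (u * n + i) % n = i := by
      rw [mul_comm, Nat.mul_add_mod, Nat.mod_eq_of_lt hi]
    rw [hh _ hlt, h₁, h₂]
  ext u v
  rw [graphOfLists, SimpleGraph.fromRel_adj, key, key, G.adj_comm v u, or_self]
  exact ⟨fun h => h.2, fun h => ⟨h.ne, h⟩⟩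

theorem readerNext_halt (T : ℕ × List ℕ → ℕ × ℕ) (A B m : ℕ) (h : List ℕ)
    (hL : n * n ≤ h.length) : ∃ b, readerNext T A B n m h = .halt b :=
  ⟨_, if_neg hL.not_gt⟩

theorem explorerNext_halt (W : List Bool → ℕ) {R D L : ℕ} (hRL : R ≤ L) (A B m : ℕ) (h : List ℕ)
    (hL : L ≤ h.length) : ∃ b, explorerNext W R D L A B n m h = .halt b := by
  refine ⟨decide (W (comparisons (L + 1) (h ++ [n])) * (A * n) ≤ B * m * R), ?_⟩
  rw [explorerNext, if_neg (hRL.trans hL).not_gt, if_neg hL.not_gt]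

theorem outputProb_run_readerNext {P : GraphProperty} {n₀ A : ℕ} (hA : 0 < A) (B m : ℕ)
    (hn : n ≤ n₀) :
    ∃ b : Bool, (b = true ↔
      ∃ G' ∈ P n, (symmDiff G.edgeSet G'.edgeSet).ncard * A ≤ B * m) ∧
      ∀ b', outputProb (run O (readerNext (editTable P n₀) A B n m) (n * n + 1) []) b' =
        if b' = b then 1 else 0 := by
  obtain ⟨h, -, hlen, hcons, hrun⟩ := exists_history O
    (next := readerNext (editTable P n₀) A B n m) (l := 0) (L := n * n)
    (fun h _ hh => ⟨_, _, if_pos hh⟩) (n * n) [] (Nat.zero_le _) (by simp)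
  have hstep : ∀ t < n * n, h.getD t 0 = O.neighborAnswer (t / n) (t % n) := by
    intro t ht
    refine hcons t (Nat.zero_le _) ht _ _ ?_
    have h₁ : (h.take t).length = t := by rw [List.length_take]; omega
    rw [readerNext, if_pos (by rwa [h₁]), h₁]
  have hmem : (n, h) ∈ (finite_adjacency_lists n₀).toFinset := by
    rw [Set.Finite.mem_toFinset]
    refine ⟨hn, hlen.trans_le (Nat.mul_le_mul hn hn), fun a ha => ?_⟩
    obtain ⟨t, ht, rfl⟩ := List.mem_iff_getElem.1 ha
    rw [← List.getD_eq_getElem h 0 ht, hstep t (hlen ▸ ht)]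
    exact (O.neighborAnswer_le _ _).trans hn
  have hhalt : readerNext (editTable P n₀) A B n m h =
      .halt (decide ((editCount P (n, h)).2 * A ≤ B * m * (editCount P (n, h)).1)) := by
    rw [readerNext, if_neg (by omega), editTable, if_pos hmem]
  refine ⟨decide ((editCount P (n, h)).2 * A ≤ B * m * (editCount P (n, h)).1), ?_, fun b' => ?_⟩
  · rw [decide_eq_true_iff, editCount_le_iff hA, graphOfLists_eq O hstep]
  · rw [add_comm, hrun 1 b']
    exact outputProb_run_halt O hhalt 0 b'

open Classical in
/-- The output after the roots have been drawn. -/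
theorem outputProb_run_explorerNext {k s R A B m : ℕ} (hs : s < n) (hk : 0 < k) (hR : 0 < R)
    {l : List (Fin n)} (hl : l.length = R) :
    ∃ b : Bool, (b = true ↔
      (l.map fun v => if v ∈ smallLeaders k s G then (1 : ℝ) else 0).sum * (A * n) ≤ B * m * R) ∧
      ∀ b', outputProb (run O (explorerNext (leaderTable (layerBound R (s + k) (s + 1)) R (s + k) k s
          (layerBound R (s + k) s) (layerBound R (s + k) (s + 1) + 1)) R (s + k)
          (layerBound R (s + k) (s + 1)) A B n m)
          (1 + (layerBound R (s + k) (s + 1) - R)) (l.map Fin.val)) b' =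
        if b' = b then 1 else 0 := by
  set D := s + k with hD
  set M := layerBound R D s with hM
  set L := layerBound R D (s + 1) with hL
  set W := leaderTable L R D k s M (L + 1) with hW
  have hRL : R ≤ L := le_layerBound _ _ _
  have hML : M ≤ L := layerBound_le_succ _ _ _
  have hRM : R ≤ M := le_layerBound _ _ _
  have hLM : L = R + M * D := rfl
  have hDpos : 0 < D := by omega
  have hlR : (l.map Fin.val).length = R := by simpa using hl
  have hnext : ∀ h : List ℕ, R ≤ h.length → h.length < L → explorerNext W R D L A B n m h =
      .neighbor (h.getD ((h.length - R) / D) 0) ((h.length - R) % D) := by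
    intro h h₁ h₂
    rw [explorerNext, if_neg h₁.not_gt, if_pos h₂]
  obtain ⟨h, hpre, hlen, hcons, hrun⟩ := exists_history O
    (next := explorerNext W R D L A B n m) (l := R) (L := L)
    (fun h h₁ h₂ => ⟨_, _, hnext h h₁ h₂⟩) (L - R) (l.map Fin.val) hlR.ge (by omega)
  set H : ℕ → ℕ := fun i => (h ++ [n]).getD i 0 with hH
  have hHh : ∀ i < L, H i = h.getD i 0 := fun i hi => List.getD_append _ _ _ _ (hlen ▸ hi)
  -- The appended `n` sits at position `L` and serves as the marker entry `z`.
  have hHz : H L = n := by simp [hH, ← hlen]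
  have hroot : ∀ i (hi : i < l.length), H i = l[i] := by
    intro i hi
    obtain ⟨r, rfl⟩ := hpre
    rw [hHh i (by omega), List.getD_append _ _ _ _ (by simpa using hi),
      List.getD_eq_getElem _ _ (by simpa using hi), List.getElem_map]
  have hstep : ∀ i < M, ∀ j < D, H (R + i * D + j) = O.neighborAnswer (H i) j := by
    intro i hi j hj
    have h₁ : R + i * D + j < L := hLM ▸ position_lt hi hj
    -- Together with `0 < R` this shows that entry `i` is known before its neighbors are requested.
    have h₂ : i ≤ i * D := Nat.le_mul_of_pos_right i hDpos
    have h₃ : (h.take (R + i * D + j)).length = R + i * D + j := by rw [List.length_take]; omega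
    have h₄ : R + i * D + j - R = i * D + j := by omega
    have h₅ : (i * D + j) / D = i := by
      rw [mul_comm, Nat.mul_add_div hDpos, Nat.div_eq_of_lt hj, add_zero]
    have h₆ : (i * D + j) % D = j := by
      rw [mul_comm, Nat.mul_add_mod, Nat.mod_eq_of_lt hj]
    have h₇ : (h.take (R + i * D + j)).getD i 0 = h.getD i 0 := by
      simp only [List.getD_eq_getElem?_getD]
      rw [List.getElem?_take_of_lt (by omega)]
    rw [hHh _ h₁, hHh i (by omega)]
    refine hcons _ (by omega) h₁ _ _ ?_
    rw [hnext _ (by omega) (by omega), h₃, h₄, h₅, h₆, h₇]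
  have hle : ∀ i < M, H i ≤ n := by
    intro i hi
    by_cases hiR : i < R
    · rw [hroot i (by omega)]
      exact (Fin.is_lt _).le
    · have h₁ : (i - R) / D < M := (Nat.div_le_self _ _).trans_lt (by omega)
      have h₂ := hstep _ h₁ _ (Nat.mod_lt (i - R) hDpos)
      have h₃ : R + (i - R) / D * D + (i - R) % D = i := by
        have := Nat.div_add_mod' (i - R) D
        omega
      rw [h₃] at h₂
      rw [h₂]
      exact O.neighborAnswer_le _ _
  have hcount : ((W (comparisons (L + 1) (h ++ [n])) : ℕ) : ℝ) =
      (l.map fun v => if v ∈ smallLeaders k s G then (1 : ℝ) else 0).sum := by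
    rw [hW, leaderTable_comparisons (by omega) (by omega) (by omega) (by omega), leaderCount,
      ← Fin.sum_univ_fun_getElem, Finset.card_filter, Nat.cast_sum,
      show Finset.range R = Finset.range l.length by rw [hl], Finset.sum_range]
    refine Finset.sum_congr rfl fun i _ => ?_
    have := displaysLeader_iff hD hHz hs hstep (hl ▸ i.2) (hroot i i.2) hle
    rw [← hM, hH] at this
    simp only [this, Nat.cast_ite, Nat.cast_one, Nat.cast_zero]
  have hhalt : explorerNext W R D L A B n m h =
      .halt (decide (W (comparisons (L + 1) (h ++ [n])) * (A * n) ≤ B * m * R)) := by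
    rw [explorerNext, if_neg (by omega), if_neg (by omega)]
  refine ⟨decide (W (comparisons (L + 1) (h ++ [n])) * (A * n) ≤ B * m * R), ?_, fun b' => ?_⟩
  · rw [decide_eq_true_iff, ← hcount]
    exact_mod_cast Iff.rfl
  · rw [hrun 1 b']
    exact outputProb_run_halt O hhalt 0 b'

open Classical in
/-- An output that requires a deviation of `R * δ` from the mean is unlikely. -/
theorem outputProb_explorerNext_le {k s R A B m : ℕ} (hn : 0 < n) (hs : s < n) (hk : 0 < k)
    (hR : 0 < R) {δ : ℝ} (hδ : 0 < δ) (hRδ : 1 ≤ R * δ ^ 2) {b : Bool}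
    (hb : ∀ x : ℝ, (b = true ↔ x * (A * n) ≤ B * m * R) →
      R * δ ≤ |x - R * ((smallLeaders k s G).ncard / n)|) :
    outputProb (run O (explorerNext (leaderTable (layerBound R (s + k) (s + 1)) R (s + k) k s
          (layerBound R (s + k) s) (layerBound R (s + k) (s + 1) + 1)) R (s + k)
          (layerBound R (s + k) (s + 1)) A B n m)
          (layerBound R (s + k) (s + 1) + 1) []) b ≤ 1 / 3 := by
  set L := layerBound R (s + k) (s + 1) with hL
  have hRL : R ≤ L := le_layerBound _ _ _
  set p : ℝ := (smallLeaders k s G).ncard / n with hp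
  have hn' : (0 : ℝ) < n := by exact_mod_cast hn
  have hR' : (0 : ℝ) < R := by exact_mod_cast hR
  set f : Fin n → ℝ := fun v => if v ∈ smallLeaders k s G then 1 else 0 with hf
  have hfsum : ∑ v, f v = n * p := by
    rw [hf, Finset.sum_boole, hp, mul_div_cancel₀ _ hn'.ne', Set.ncard_eq_toFinset_card']
    congr 2
    ext v
    simp
  have hfsq : ∀ v, f v ^ 2 = f v := fun v => by
    simp only [hf]; split_ifs <;> norm_num
  have hlist : ∀ l : List (Fin n), (l.map fun v => f v - p).sum = (l.map f).sum - l.length * p := by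
    intro l
    induction l with
    | nil => simp
    | cons a l ih => simp only [List.map_cons, List.sum_cons, ih, List.length_cons]; push_cast; ring
  have main := outputProb_run_draws_le O (R := R) (T := 1 + (L - R)) (b := b)
    (next := explorerNext (leaderTable L R (s + k) k s (layerBound R (s + k) s) (L + 1)) R (s + k)
      L A B n m)
    (g := fun v => f v - p) (ρ := ((R * δ) ^ 2)⁻¹) hn (by positivity) (fun h hh => if_pos hh)
    (by rw [Finset.sum_sub_distrib, hfsum]; simp)
    (by
      have h₁ : ∀ v, (f v - p) ^ 2 = f v - 2 * p * f v + p ^ 2 := fun v => by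
        rw [sub_sq, hfsq]; ring
      simp only [h₁, Finset.sum_add_distrib, Finset.sum_sub_distrib, ← Finset.mul_sum, hfsum]
      simp only [Finset.sum_const, Finset.card_univ, Fintype.card_fin, nsmul_eq_mul]
      -- The variance of an indicator is p(1 - p) ≤ 1/4.
      nlinarith [mul_nonneg hn'.le (sq_nonneg (p - 1 / 2))])
    (by
      intro l hl
      obtain ⟨b', hb', hrun⟩ := outputProb_run_explorerNext (A := A) (B := B) (m := m) O hs hk hR hl
      rw [hrun]
      -- If the output is `b`, the deviation is at least `R * δ`, so the squared deviation times `ρ`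
      -- is at least 1; otherwise the probability is 0.
      split_ifs with hbb
      · subst hbb
        have h₁ := hb _ hb'
        rw [ENNReal.one_le_ofReal, ← div_eq_mul_inv, one_le_div (by positivity), hlist, hl,
          ← sq_abs ((l.map f).sum - R * p)]
        exact pow_le_pow_left₀ (by positivity) h₁ 2
      · exact zero_le)
    R [] (by simp)
  have h₁ : 1 + (L - R) + R = L + 1 := by omega
  rw [h₁] at main
  refine main.trans ?_
  have h₂ : (([].map fun v => f v - p).sum ^ 2 + (R : ℝ) / 4) * ((R * δ) ^ 2)⁻¹ ≤ 1 / 3 := by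
    rw [← div_eq_mul_inv, div_le_iff₀ (by positivity)]
    simp only [List.map_nil, List.sum_nil]
    nlinarith
  refine (ENNReal.ofReal_le_ofReal h₂).trans ?_
  rw [ENNReal.ofReal_div_of_pos (by norm_num)]
  simp

end Correctness

/-! ### The tester -/

section Tester

/-- The far case in numbers. Dividing the distance bound by `k` leaves ℓ' ≥ (2ε + η)m - (k + 1). The
term k + 1 and the large sets cost at most naη/16 each. Of the remaining slack ηm/4 ≥ naη/4 over qm,
at least naη/8 survives. -/
theorem le_of_dist_bounds {k s n m d ℓ ℓ' : ℕ} {a ε η q : ℝ} (hk : 1 ≤ k)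
    (hη : 0 < η) (hq : q ≤ 2 * ε + 3 * η / 4) (hs : 1 / ((s : ℝ) + 1) ≤ a * η / 16)
    (hn : (k : ℝ) + 1 ≤ n * (a * η / 16)) (hm : a * n ≤ m) (hd : (2 * ε + η) * k * m < d)
    (hdℓ : d ≤ k * ℓ' + k * (k + 1)) (hℓ : (s + 1) * ℓ' ≤ (s + 1) * ℓ + n) :
    q * m + n * (a * η / 8) ≤ ℓ := by
  have hk' : (0 : ℝ) < k := by exact_mod_cast hk
  have hs' : (0 : ℝ) < (s : ℝ) + 1 := by positivity
  have h₁ : (d : ℝ) ≤ k * (ℓ' + (k + 1)) := by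
    have : (d : ℝ) ≤ k * ℓ' + k * (k + 1) := by exact_mod_cast hdℓ
    linarith
  have h₂ : (2 * ε + η) * m ≤ ℓ' + (k + 1) := by
    refine le_of_mul_le_mul_left ?_ hk'
    linarith
  have h₃ : (ℓ' : ℝ) ≤ ℓ + n * (1 / ((s : ℝ) + 1)) := by
    have : ((s : ℝ) + 1) * ℓ' ≤ (s + 1) * ℓ + n := by exact_mod_cast hℓ
    refine le_of_mul_le_mul_left ?_ hs'
    calc _ ≤ _ := this
      _ = _ := by field_simp
  have h₄ : (n : ℝ) * (1 / ((s : ℝ) + 1)) ≤ n * (a * η / 16) := by gcongr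
  have h₅ : q * m ≤ (2 * ε + 3 * η / 4) * m := by gcongr
  have h₆ : a * n * (η / 4) ≤ m * (η / 4) := by gcongr
  linarith

theorem exists_isTolerantTester (k : ℕ) (hk : 1 ≤ k) (a β ε ε₂ : ℝ) (ha : 0 < a) (hβ : 0 < β)
    (hε : 0 < ε) (hε₂ : 2 * k * ε + β ≤ ε₂) :
    ∃ A : Algorithm, IsTolerantTester a ε ε₂ (kEdgeConnectivity k) A := by
  have hk' : (1 : ℝ) ≤ k := by exact_mod_cast hk
  obtain ⟨η, hη, hηk⟩ : ∃ η : ℝ, 0 < η ∧ η * k = β := ⟨β / k, by positivity, by field_simp⟩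
  -- The acceptance threshold for ℓ / m separates 2ε, the bound for close graphs, from 2ε + η, the
  -- approximate bound for far ones. It is rational so that the test is an integer inequality.
  obtain ⟨q, hq₁, hq₂⟩ := exists_rat_btwn (show 2 * ε + η / 4 < 2 * ε + 3 * η / 4 by linarith)
  have hq₀ : (0 : ℝ) < q := by linarith
  obtain ⟨A, B, hA, hBA⟩ : ∃ A B : ℕ, 0 < A ∧ (B : ℝ) = q * A := by
    refine ⟨q.den, q.num.toNat, q.den_pos, ?_⟩
    have h₁ : (0 : ℤ) ≤ q.num := Rat.num_nonneg.2 (by exact_mod_cast hq₀.le)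
    have h₂ : ((q.num.toNat : ℤ) : ℚ) = q * q.den := by
      rw [Int.toNat_of_nonneg h₁, Rat.mul_den_eq_num]
    exact_mod_cast h₂
  have hA' : (0 : ℝ) < A := by exact_mod_cast hA
  have haη : 0 < a * η / 16 := by positivity
  obtain ⟨s, hs⟩ := exists_nat_one_div_lt haη
  obtain ⟨N, hN⟩ := exists_nat_ge (((k : ℝ) + 1) / (a * η / 16))
  set n₀ := N + s + k with hn₀
  set δ := a * η / 8 with hδ
  have hδ₀ : 0 < δ := by positivity
  -- With this many roots Chebyshev's bound 1 / (4Rδ²) is at most 1/4.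
  obtain ⟨R, hR⟩ := exists_nat_ge (1 / δ ^ 2)
  have hRδ : 1 ≤ R * δ ^ 2 := (div_le_iff₀ (by positivity)).1 hR
  have hR₀ : 0 < R := by
    rcases Nat.eq_zero_or_pos R with rfl | h
    · norm_num at hRδ
    · exact h
  have hR₀' : (0 : ℝ) < R := by exact_mod_cast hR₀
  set L := layerBound R (s + k) (s + 1) with hL
  set W := leaderTable L R (s + k) k s (layerBound R (s + k) s) (L + 1) with hW
  set P := kEdgeConnectivity k with hP
  refine ⟨⟨sizeSwitch n₀ (readerNext (editTable P n₀) A B) (explorerNext W R (s + k) L A B),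
    (primrec_sizeSwitch n₀ (primrec_readerNext (primrec_editTable P n₀) A B)
      (primrec_explorerNext (primrec_leaderTable _ _ _ _ _ _ _) R (s + k) L A B)).to_comp⟩,
    fun _ => n₀ * n₀ + L, ?_, ?_⟩
  -- The query bound is a constant, the sum of the bounds of the two strategies.
  · refine Asymptotics.isLittleO_const_left.2 (Or.inr ?_)
    exact tendsto_norm_atTop_atTop.comp tendsto_natCast_atTop_atTop
  intro n m hn hm
  have hn' : (0 : ℝ) < n := by exact_mod_cast hn
  have hm₀' : (0 : ℝ) < m := (mul_pos ha hn').trans_le hm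
  have hm₀ : 0 < m := by exact_mod_cast hm₀'
  have hε₂' : 0 ≤ ε₂ := le_trans (by positivity) hε₂
  by_cases hnn₀ : n ≤ n₀
  · have hnext : sizeSwitch n₀ (readerNext (editTable P n₀) A B)
        (explorerNext W R (s + k) L A B) n m = readerNext (editTable P n₀) A B n m :=
      funext fun h => if_pos hnn₀
    refine ⟨n * n + 1, fun G _ O => ?_⟩
    simp only [hnext]
    obtain ⟨b, hb, hprob⟩ := outputProb_run_readerNext (P := P) O hA B m hnn₀
    have hacc : acceptProb (run O (readerNext (editTable P n₀) A B n m) (n * n + 1) []) =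
        if true = b then 1 else 0 := hprob true
    refine ⟨fun o ho => ?_, fun h => ?_, fun h => ?_⟩
    · obtain ⟨b, c, rfl, hc⟩ := run_support O (readerNext_halt (editTable P n₀) A B m) (n * n + 1)
        [] (Nat.zero_le _) le_rfl o ho
      have := Nat.mul_le_mul hnn₀ hnn₀
      exact ⟨b, c, rfl, by simp only [List.length_nil] at hc; omega⟩
    · obtain ⟨G', hG', hd⟩ := (isClose_iff hm₀ hε.le).1 h
      rw [hacc, if_pos (hb.2 ⟨G', hG', ?_⟩).symm]
      · exact ENNReal.div_le_of_le_mul (by norm_num)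
      · have : ((symmDiff G.edgeSet G'.edgeSet).ncard : ℝ) * A ≤ B * m := by
          rw [hBA]
          have : ((symmDiff G.edgeSet G'.edgeSet).ncard : ℝ) ≤ q * m := hd.trans (by gcongr; linarith)
          nlinarith
        exact_mod_cast this
    · have hbf : ¬ true = b := by
        intro hbt
        obtain ⟨G', hG', hd⟩ := hb.1 hbt.symm
        refine h ((isClose_iff hm₀ hε₂').2 ⟨G', hG', ?_⟩)
        have h₁ : ((symmDiff G.edgeSet G'.edgeSet).ncard : ℝ) * A ≤ B * m := by exact_mod_cast hd
        have h₂ : ((symmDiff G.edgeSet G'.edgeSet).ncard : ℝ) ≤ q * m := by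
          refine le_of_mul_le_mul_right ?_ hA'
          rw [hBA] at h₁
          linarith
        refine h₂.trans (mul_le_mul_of_nonneg_right ?_ hm₀'.le)
        nlinarith
      rw [hacc, if_neg hbf]
      exact zero_le
  · have hnext : sizeSwitch n₀ (readerNext (editTable P n₀) A B)
        (explorerNext W R (s + k) L A B) n m = explorerNext W R (s + k) L A B n m :=
      funext fun h => if_neg hnn₀
    have hsn : s < n := by omega
    have hkn : k < n := by omega
    have hNn : (k : ℝ) + 1 ≤ n * (a * η / 16) := by
      refine ((div_le_iff₀ haη).1 hN).trans ?_
      gcongr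
      omega
    refine ⟨L + 1, fun G _ O => ?_⟩
    simp only [hnext]
    have hsupp : ∀ o ∈ (run O (explorerNext W R (s + k) L A B n m) (L + 1) []).support,
        ∃ (b : Bool) (c : ℕ), o = some (b, c) ∧ c ≤ L :=
      run_support O (explorerNext_halt W (le_layerBound _ _ _) A B m) (L + 1) [] (Nat.zero_le _)
        le_rfl
    set ℓ := (smallLeaders k s G).ncard with hℓ
    have hmean : ∀ x : ℝ, x - R * (ℓ / n) = (x * n - R * ℓ) / n := fun x => by field_simp
    refine ⟨fun o ho => ?_, fun h => ?_, fun h => ?_⟩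
    · obtain ⟨b, c, rfl, hc⟩ := hsupp o ho
      exact ⟨b, c, rfl, by omega⟩
    · obtain ⟨G', hG', hd⟩ := (isClose_iff hm₀ hε.le).1 h
      have hfalse := outputProb_explorerNext_le (A := A) (B := B) (m := m) (b := false) O hn hsn hk
        hR₀ hδ₀ hRδ (fun x hx => by
          have hx' : B * m * R < x * (A * n) := by simpa using hx
          have h₁ : (ℓ : ℝ) ≤ 2 * (ε * m) := by
            have : ℓ ≤ 2 * (symmDiff G.edgeSet G'.edgeSet).ncard :=
              (Set.ncard_le_ncard smallLeaders_subset_leaders (Set.toFinite _)).trans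
                (ncard_leaders_le hG')
            have : (ℓ : ℝ) ≤ 2 * (symmDiff G.edgeSet G'.edgeSet).ncard := by exact_mod_cast this
            linarith
          -- Rejection means that the sample exceeds the threshold, whereas ℓ ≤ 2εm lies below it by
          -- ηm/4 ≥ 2δn.
          have h₂ : q * m * R ≤ x * n := by
            refine le_of_mul_le_mul_left ?_ hA'
            rw [hBA] at hx'
            linarith
          have h₃ : (2 * ε + η / 4) * (m * R) ≤ q * (m * R) := by gcongr
          have h₄ : a * n * (η / 4 * R) ≤ m * (η / 4 * R) := by gcongr
          have h₅ : R * ℓ ≤ R * (2 * (ε * m)) := by gcongr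
          refine le_trans ?_ (le_abs_self _)
          rw [hmean, le_div_iff₀ hn', hδ]
          have h₆ : 0 ≤ a * n * (η * R) := by positivity
          linarith)
      have hsum := outputProb_true_add_false fun o ho => by
        obtain ⟨b, c, h, -⟩ := hsupp o ho
        exact ⟨b, c, h⟩
      have h₂ : (2 / 3 : ℝ≥0∞) + 1 / 3 = 1 := by
        rw [ENNReal.div_add_div_same]
        norm_num
        exact ENNReal.div_self (by norm_num) (by norm_num)
      refine ENNReal.le_of_add_le_add_right (a := 1 / 3) (by simp) ?_
      rw [h₂]
      exact hsum.symm.le.trans (add_le_add le_rfl hfalse)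
    · refine outputProb_explorerNext_le (b := true) O hn hsn hk hR₀ hδ₀ hRδ fun x hx => ?_
      have hx' : x * (A * n) ≤ B * m * R := by simpa using hx
      obtain ⟨G', hG', hd⟩ := exists_kEdgeConnected_of_lt G hkn
      have hfar : ε₂ * m < (symmDiff G.edgeSet G'.edgeSet).ncard := by
        by_contra! hle
        exact h ((isClose_iff hm₀ hε₂').2 ⟨G', hG', hle⟩)
      have h₁ : (2 * ε + η) * k * m ≤ ε₂ * m := by
        gcongr
        linarith
      have h₂ := le_of_dist_bounds hk hη hq₂.le hs.le hNn hm (h₁.trans_lt hfar) hd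
        (ncard_leaders_le_add s)
      have h₃ : x * n ≤ q * m * R := by
        refine le_of_mul_le_mul_left ?_ hA'
        rw [hBA] at hx'
        linarith
      rw [abs_sub_comm]
      refine le_trans ?_ (le_abs_self _)
      rw [← neg_sub, hmean, ← neg_div, le_div_iff₀ hn']
      have h₄ : (R : ℝ) * (q * m + n * δ) ≤ R * ℓ := by gcongr
      linarith

end Tester

end GraphTesting

theorem corollaryc (k : ℕ) (hk : 1 ≤ k) (a α β c ε : ℝ)
    (ha : 0 < a) (hα : 0 < α) (hβ : 0 < β) (hc : 0 < c) (hε : 0 < ε) :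
    ∃ A : GraphTesting.Algorithm,
      GraphTesting.IsTolerantTester a ε ((2 * (k : ℝ) + α) * ε + c * (k : ℝ) / 2 + β)
        (GraphTesting.kEdgeConnectivity k) A := by
  refine GraphTesting.exists_isTolerantTester k hk a β ε _ ha hβ hε ?_
  -- The bound 2kε + β is already attained; the other terms only weaken it.
  have h₁ : 0 ≤ α * ε := by positivity
  have h₂ : 0 ≤ c * k / 2 := by positivity
  linarith
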